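/- Let $\Pi=(P,\mathcal L)$ be a polar space of type $\mathsf D_n$ with $n\ge 4$. That is, $\Pi$ is a partial linear space satisfying the Buekenhout–Shult axioms: every line has at least three points; no point is collinear with all points; for every point $p$ and line $L$, $p$ is collinear with exactly one or with all points of $L$; every flag of singular subspaces is finite. Its maximal singular subspaces are all $(n-1)$-dimensional, and every $(n-2)$-dimensional singular subspace lies in precisely two maximal singular subspaces. Let $\Gamma_{n-1}(\Pi)$ be the graph whose vertices are the maximal singular subspaces, two of them being adjacent when their intersection is $(n-2)$-dimensional. The vertex set splits into two half-spin Grassmannians $\mathcal G_+(\Pi)$ and $\mathcal G_-(\Pi)$: the distance in $\Gamma_{n-1}(\Pi)$ is even within each of them and odd between elements of different ones. For $\delta\in\{+,-\}$ let $\Gamma_\delta(\Pi)$ be the graph with vertex set $\mathcal G_\delta(\Pi)$ in which two distinct elements are adjacent when their intersection is $(n-3)$-dimensional. A *star* of $\mathcal G_\delta(\Pi)$ is the set of all elements of $\mathcal G_\delta(\Pi)$ containing a given $(n-4)$-dimensional singular subspace; a *special subspace* is the set of all $S\in\mathcal G_\delta(\Pi)$ such that $S\cap U$ is $(n-2)$-dimensional,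 for a given $U\in\mathcal G_{-\delta}(\Pi)$. Let $\frac12H_m$, $m\ge 4$, be the half-cube graph: its vertices are the elements of $\{0,1\}^m$ with an even number of ones, two of them being adjacent when they differ in exactly two coordinates. A *star* of $\frac12H_m$ is the set of all its vertices with prescribed values of some $m-3$ coordinates (it has $4$ elements); a *special subset* is the set of all its vertices which differ in exactly one coordinate from a given element of $\{0,1\}^m$ with an odd number of ones (it has $m$ elements). **Proposition.** Let $f$ be an embedding of $\frac12H_m$ in $\Gamma_\delta(\Pi)$, $\delta\in\{+,-\}$, i.e. an injective map of the vertex sets such that two vertices are adjacent if and only if their images are adjacent ($f$ is not assumed to be isometric). Then exactly one of the following possibilities is realized: (A) the image of every star is contained in a star and the image of every special subset is contained in a special subspace; (B) the image of every star is contained in a special subspace and the image of every special subset is contained in a star. -/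

import Mathlib

/-- A partial linear space on the (non-empty) point set `P`. -/
structure PartialLinearSpace (P : Type*) where
  lines : Set (Set P)
  nonempty : Nonempty P
  line_proper : ∀ L ∈ lines, L ≠ Set.univ
  two_points : ∀ L ∈ lines, L.Nontrivial
  point_on_line : ∀ p : P, ∃ L ∈ lines, p ∈ L
  line_unique : ∀ p q : P, p ≠ q → ∀ L ∈ lines, ∀ L' ∈ lines,
    p ∈ L → q ∈ L → p ∈ L' → q ∈ L' → L = L'

namespace PartialLinearSpace

variable {P : Type*} (G : PartialLinearSpace P)

/-- Collinearity; every point is collinear with itself, since it lies on a line. -/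
def Collinear (p q : P) : Prop := ∃ L ∈ G.lines, p ∈ L ∧ q ∈ L

def IsSubspace (S : Set P) : Prop :=
  ∀ p ∈ S, ∀ q ∈ S, p ≠ q → ∀ L ∈ G.lines, p ∈ L → q ∈ L → L ⊆ S

def IsSingular (S : Set P) : Prop :=
  G.IsSubspace S ∧ ∀ p ∈ S, ∀ q ∈ S, p ≠ q → G.Collinear p q

def IsMaximalSingular (S : Set P) : Prop := Maximal G.IsSingular S

/-- The subspace spanned by a set of points. -/
def span (X : Set P) : Set P := ⋂₀ {S | G.IsSubspace S ∧ X ⊆ S}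

def IsIndependent (X : Set P) : Prop := ∀ Y : Set P, Y ⊂ X → G.span Y ≠ G.span X

def IsBase (X S : Set P) : Prop := X ⊆ S ∧ G.IsIndependent X ∧ G.span X = S

/-- `S` has the finite (projective) dimension `d`: the number `d` is the smallest one such that `S`
has a base of cardinality `d + 1`. Points have dimension `0`, lines have dimension `1`; the empty
set, whose dimension is `-1`, has no dimension `d : ℕ`. -/
def HasDim (S : Set P) (d : ℕ) : Prop :=
  IsLeast {k : ℕ | ∃ X : Set P, G.IsBase X S ∧ X.encard = k + 1} d

end PartialLinearSpace

/-- A polar space, by the axioms of Buekenhout and Shult. -/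
structure PolarSpace (P : Type*) extends PartialLinearSpace P where
  three_points : ∀ L ∈ lines, 3 ≤ L.encard
  no_radical : ¬ ∃ p : P, ∀ q : P, toPartialLinearSpace.Collinear p q
  one_or_all : ∀ p : P, ∀ L ∈ lines,
    (∃! q, q ∈ L ∧ toPartialLinearSpace.Collinear p q) ∨
      ∀ q ∈ L, toPartialLinearSpace.Collinear p q
  flag_finite : ∀ C : Set (Set P), (∀ S ∈ C, toPartialLinearSpace.IsSingular S) →
    IsChain (· ⊆ ·) C → C.Finite

namespace PolarSpace

variable {P : Type*} (Q : PolarSpace P)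

/-- Rank `n` (used for `n ≥ 1`): the maximal singular subspaces have dimension `n - 1`. -/
def HasRank (n : ℕ) : Prop :=
  ∀ M : Set P, Q.IsMaximalSingular M → Q.HasDim M (n - 1)

/-- Type `D_n` (used for `n ≥ 2`): the rank is `n` and every `(n - 2)`-dimensional singular subspace
is contained in precisely two maximal singular subspaces. -/
def IsTypeD (n : ℕ) : Prop :=
  Q.HasRank n ∧ ∀ N : Set P, Q.IsSingular N → Q.HasDim N (n - 2) →
    {M : Set P | Q.IsMaximalSingular M ∧ N ⊆ M}.encard = 2

/-- The polar Grassmannian of `k`-dimensional singular subspaces. -/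
def grassmannian (k : ℕ) : Set (Set P) := {S | Q.IsSingular S ∧ Q.HasDim S k}

/-- The Grassmann graph `Γ_{n-1}` of the dual polar space, for rank `n ≥ 2`: two distinct elements
are adjacent if their intersection is `(n - 2)`-dimensional. -/
def dualPolarGraph (n : ℕ) : SimpleGraph (Q.grassmannian (n - 1)) where
  Adj S U := S ≠ U ∧ Q.HasDim (S.1 ∩ U.1) (n - 2)
  symm := ⟨fun S U h => ⟨h.1.symm, by rw [Set.inter_comm]; exact h.2⟩⟩
  loopless := ⟨fun _ h => h.1 rfl⟩

/-- The half-spin Grassmannian with sign `δ ∈ {1, -1}`, where `1` is the sign of the class of the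
maximal singular subspace `S₀`: it consists of all maximal singular subspaces whose distance to `S₀`
in the dual polar graph is even (if `δ = 1`) or odd (if `δ = -1`). -/
def halfSpin (n : ℕ) (S₀ : Q.grassmannian (n - 1)) (δ : ℤˣ) : Set (Q.grassmannian (n - 1)) :=
  {S | (-1 : ℤˣ) ^ (Q.dualPolarGraph n).dist S₀ S = δ}

/-- If the maximal singular subspaces are decomposed in two disjoint sets so that distances within
each of the sets are even and distances between elements of distinct sets are odd, then these sets
are the two half-spin Grassmannians defined above. -/
theorem halfSpin_eq_of_decomposition (n : ℕ) (A B : Set (Q.grassmannian (n - 1)))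
    (hAB : A ∪ B = Set.univ)
    (hA : ∀ S ∈ A, ∀ U ∈ A, Even ((Q.dualPolarGraph n).dist S U))
    (hodd : ∀ S ∈ A, ∀ U ∈ B, Odd ((Q.dualPolarGraph n).dist S U))
    (S₀ : Q.grassmannian (n - 1)) (h₀ : S₀ ∈ A) :
    Q.halfSpin n S₀ 1 = A ∧ Q.halfSpin n S₀ (-1) = B := by
  have hne : (1 : ℤˣ) ≠ -1 := by decide
  have key : ∀ S, S ∈ A ∨ S ∈ B := fun S => by
    have : S ∈ A ∪ B := hAB ▸ Set.mem_univ S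
    exact this
  constructor
  · ext S
    refine ⟨fun h => (key S).resolve_right fun hB => ?_, fun h => (hA S₀ h₀ S h).neg_one_pow⟩
    exact hne (h.symm.trans (hodd S₀ h₀ S hB).neg_one_pow)
  · ext S
    refine ⟨fun h => (key S).resolve_left fun hS => ?_, fun h => (hodd S₀ h₀ S h).neg_one_pow⟩
    exact hne ((hA S₀ h₀ S hS).neg_one_pow.symm.trans h)

/-- The half-spin Grassmann graph `Γ_δ`, for rank `n ≥ 3`: two distinct elements are adjacent if
their intersection is `(n - 3)`-dimensional. -/
def halfSpinGraph (n : ℕ) (S₀ : Q.grassmannian (n - 1)) (δ : ℤˣ) :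
    SimpleGraph (Q.halfSpin n S₀ δ) where
  Adj S U := S ≠ U ∧ Q.HasDim (S.1.1 ∩ U.1.1) (n - 3)
  symm := ⟨fun S U h => ⟨h.1.symm, by rw [Set.inter_comm]; exact h.2⟩⟩
  loopless := ⟨fun _ h => h.1 rfl⟩

/-- Stars of the half-spin Grassmannian (rank `n ≥ 4`): all its elements that contain a given
`(n - 4)`-dimensional singular subspace. -/
def IsStar (n : ℕ) (S₀ : Q.grassmannian (n - 1)) (δ : ℤˣ) (C : Set (Q.halfSpin n S₀ δ)) : Prop :=
  ∃ M ∈ Q.grassmannian (n - 4), C = {S | M ⊆ S.1.1}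

/-- Special subspaces of the half-spin Grassmannian: all its elements that meet a given element of
the other half-spin Grassmannian in an `(n - 2)`-dimensional subspace. -/
def IsSpecialSubspace (n : ℕ) (S₀ : Q.grassmannian (n - 1)) (δ : ℤˣ)
    (C : Set (Q.halfSpin n S₀ δ)) : Prop :=
  ∃ U ∈ Q.halfSpin n S₀ (-δ), C = {S | Q.HasDim (S.1.1 ∩ U.1) (n - 2)}

end PolarSpace

namespace HalfCube

/-- The number of coordinates of a vertex of the `m`-dimensional hypercube that are equal to `1`. -/
def weight {m : ℕ} (v : Fin m → Bool) : ℕ := (Finset.univ.filter fun i => v i = true).card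

/-- The vertices of the half-cube: the vertices of the hypercube with even weight. -/
abbrev Vertex (m : ℕ) : Type := {v : Fin m → Bool // Even (weight v)}

/-- The half-cube graph `½H_m`: two vertices are adjacent if they differ in exactly two
coordinates. -/
def graph (m : ℕ) : SimpleGraph (Vertex m) where
  Adj v w := hammingDist v.1 w.1 = 2
  symm := ⟨fun v w h => by rw [hammingDist_comm]; exact h⟩
  loopless := ⟨fun v h => by simp at h⟩

/-- Stars of the half-cube (`m ≥ 3`): all vertices with prescribed values of `m - 3` of their
coordinates. -/
def IsStar {m : ℕ} (X : Set (Vertex m)) : Prop :=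
  ∃ T : Finset (Fin m), T.card = m - 3 ∧ ∃ u : Fin m → Bool, X = {v | ∀ i ∈ T, v.1 i = u i}

/-- Special subsets of the half-cube: all vertices adjacent in the hypercube with a given vertex of
odd weight. -/
def IsSpecialSubset {m : ℕ} (X : Set (Vertex m)) : Prop :=
  ∃ u : Fin m → Bool, Odd (weight u) ∧ X = {v | hammingDist v.1 u = 1}

end HalfCube

/-!
Stars and special subspaces are cliques of the half-spin Grassmann graph, and a triangle which is
not contained in a line of the half-spin Grassmannian lies in precisely one star and in precisely
one special subspace; every vertex adjacent to all three vertices of the triangle is in one of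
these two cliques (`PolarSpace.IsTypeD.exists_star_special`). A star and a special subset of the
half-cube that meet in a triangle `T` are the cliques `T ∪ {x}` and `T ∪ Y`, where `x` is not
adjacent to any vertex of `Y ≠ ∅`. The image of `T` is not on a line, because a vertex adjacent to
two points of a line is adjacent to all its other points. Since `f` preserves non-adjacency, `f x`
and the vertices of `f '' Y` are in different ones of the two cliques that contain `f '' T`
(`inStar_xor_inSpecial`). So the type of the image of a star determines the type of the image of
each special subset meeting it in a triangle, and conversely; as any two special subsets are
joined by a sequence in which consecutive ones meet a common star in triangles, the types of all
images are determined by one of them (`inSpecial_iff`).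

The facts on half-spin Grassmannians come down to a dimension theory of singular subspaces. That
they are projective spaces (`PolarSpace.veblen`) is derived from the axioms by separating points,
then points and lines, by the perps of points, first in the polar space and then in its subspaces
`{p, q}^⊥` with `p`, `q` non-collinear. The Veblen–Young axiom says that a singular subspace `S`
is a hyperplane in its join with a further point; from this follow the exchange property, hence
the existence of a rank function that is strictly monotone, and the inequality `rank S + rank T ≤
rank (S ∩ T) + rank A` for `S, T ⊆ A` (`PolarSpace.rank_add_rank_le`). In type `D_n` the rank of
the intersection with a fixed maximal singular subspace changes by precisely `1` along the edges
of the dual polar graph (`PolarSpace.IsTypeD.rank_inter_adj`), so the parity of `n - rank (S ∩ U)`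
tells whether `S` and `U` belong to the same half-spin Grassmannian.
-/

open PartialLinearSpace

/-! ### Perps and the Veblen–Young axiom -/

namespace PartialLinearSpace

variable {P : Type*} {G : PartialLinearSpace P}

theorem Collinear.symm {p q : P} (h : G.Collinear p q) : G.Collinear q p :=
  let ⟨L, hL, hp, hq⟩ := h
  ⟨L, hL, hq, hp⟩

theorem collinear_self (p : P) : G.Collinear p p :=
  let ⟨L, hL, hp⟩ := G.point_on_line p
  ⟨L, hL, hp, hp⟩

theorem collinear_of_mem {L : Set P} (hL : L ∈ G.lines) {p q : P} (hp : p ∈ L) (hq : q ∈ L) :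
    G.Collinear p q := ⟨L, hL, hp, hq⟩

theorem subset_span (X : Set P) : X ⊆ G.span X := fun _ hx _ hS => hS.2 hx

theorem span_subset {X S : Set P} (hS : G.IsSubspace S) (h : X ⊆ S) : G.span X ⊆ S :=
  fun _ hx => hx S ⟨hS, h⟩

theorem isSubspace_span (X : Set P) : G.IsSubspace (G.span X) :=
  fun p hp q hq hpq L hL hpL hqL _ hr S hS =>
    hS.1 p (hp S hS) q (hq S hS) hpq L hL hpL hqL hr

theorem span_mono {X Y : Set P} (h : X ⊆ Y) : G.span X ⊆ G.span Y :=
  span_subset (isSubspace_span Y) (h.trans (subset_span Y))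

theorem IsSubspace.span_eq {S : Set P} (hS : G.IsSubspace S) : G.span S = S :=
  (span_subset hS subset_rfl).antisymm (subset_span S)

theorem IsSubspace.inter {S T : Set P} (hS : G.IsSubspace S) (hT : G.IsSubspace T) :
    G.IsSubspace (S ∩ T) :=
  fun p hp q hq hpq L hL hpL hqL =>
    Set.subset_inter (hS p hp.1 q hq.1 hpq L hL hpL hqL) (hT p hp.2 q hq.2 hpq L hL hpL hqL)

theorem IsSubspace.empty : G.IsSubspace (∅ : Set P) := fun _ hp => hp.elim

theorem IsSubspace.line_subset {S : Set P} (hS : G.IsSubspace S) {p q : P} (hp : p ∈ S)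
    (hq : q ∈ S) (hpq : p ≠ q) {L : Set P} (hL : L ∈ G.lines) (hpL : p ∈ L) (hqL : q ∈ L) :
    L ⊆ S := hS p hp q hq hpq L hL hpL hqL

theorem IsSingular.collinear {S : Set P} (hS : G.IsSingular S) {p q : P} (hp : p ∈ S)
    (hq : q ∈ S) : G.Collinear p q := by
  by_cases h : p = q
  · exact h ▸ collinear_self p
  · exact hS.2 p hp q hq h

theorem IsSingular.mono {S T : Set P} (hT : G.IsSingular T) (hS : G.IsSubspace S) (h : S ⊆ T) :
    G.IsSingular S := ⟨hS, fun p hp q hq => hT.2 p (h hp) q (h hq)⟩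

theorem span_insert_span (p : P) (X : Set P) :
    G.span (insert p (G.span X)) = G.span (insert p X) := by
  apply (span_subset (isSubspace_span _) (Set.insert_subset _ _)).antisymm
  · exact span_mono (Set.insert_subset_insert (subset_span X))
  · exact subset_span _ (Set.mem_insert p X)
  · exact span_mono (Set.subset_insert p X)

end PartialLinearSpace

namespace PolarSpace

variable {P : Type*} {Q : PolarSpace P}

theorem collinear_of_two {r x y z : P} {L : Set P} (hL : L ∈ Q.lines) (hx : x ∈ L) (hy : y ∈ L)
    (hxy : x ≠ y) (hrx : Q.Collinear r x) (hry : Q.Collinear r y) (hz : z ∈ L) :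
    Q.Collinear r z := by
  rcases Q.one_or_all r L hL with ⟨q, -, hq⟩ | h
  · exact absurd ((hq x ⟨hx, hrx⟩).trans (hq y ⟨hy, hry⟩).symm) hxy
  · exact h z hz

theorem exists_collinear_on_line (r : P) {L : Set P} (hL : L ∈ Q.lines) :
    ∃ q ∈ L, Q.Collinear r q := by
  rcases Q.one_or_all r L hL with ⟨q, hq, -⟩ | h
  · exact ⟨q, hq⟩
  · obtain ⟨q, hq⟩ := (Q.two_points L hL).nonempty
    exact ⟨q, hq, h q hq⟩

variable (Q) in
/-- The set `X^⊥` of all points collinear with every point of `X`. -/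
def perp (X : Set P) : Set P := {p | ∀ x ∈ X, Q.Collinear p x}

theorem isSubspace_perp (X : Set P) : Q.IsSubspace (Q.perp X) :=
  fun _ hp _ hq hpq _ hL hpL hqL _ hr x hx =>
    (collinear_of_two hL hpL hqL hpq (hp x hx).symm (hq x hx).symm hr).symm

theorem subset_perp_comm {X Y : Set P} (h : X ⊆ Q.perp Y) : Y ⊆ Q.perp X :=
  fun _ hy _ hx => (h hx _ hy).symm

theorem perp_anti {X Y : Set P} (h : X ⊆ Y) : Q.perp Y ⊆ Q.perp X :=
  fun _ hp x hx => hp x (h hx)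

theorem perp_span (X : Set P) : Q.perp (Q.span X) = Q.perp X :=
  (perp_anti (subset_span X)).antisymm <|
    subset_perp_comm (span_subset (isSubspace_perp _) (subset_perp_comm subset_rfl))

theorem isSingular_span {X : Set P} (h : X ⊆ Q.perp X) : Q.IsSingular (Q.span X) := by
  refine ⟨isSubspace_span X, fun p hp q hq _ => ?_⟩
  have h1 : Q.span X ⊆ Q.perp (Q.span X) := by
    rw [perp_span]
    exact span_subset (isSubspace_perp X) h
  exact h1 hp q hq

theorem isSingular_span_insert {S : Set P} (hS : Q.IsSingular S) {p : P} (hp : p ∈ Q.perp S) :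
    Q.IsSingular (Q.span (insert p S)) := by
  apply isSingular_span
  rintro x (rfl | hx) y (rfl | hy)
  · exact collinear_self _
  · exact hp y hy
  · exact (hp x hx).symm
  · exact hS.collinear hx hy

variable (Q) in
/-- A subspace `W` is nondegenerate if no point of `W` is collinear with all points of `W`. Such
subspaces are polar spaces in their own right; statements about them are used for the subspaces
`{x, y}^⊥` with `x`, `y` non-collinear. -/
def IsNondegenerate (W : Set P) : Prop :=
  Q.IsSubspace W ∧ ∀ z ∈ W, ∃ w ∈ W, ¬ Q.Collinear w z

theorem isNondegenerate_univ : Q.IsNondegenerate Set.univ := by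
  refine ⟨fun _ _ _ _ _ L _ _ _ => Set.subset_univ L, fun z _ => ?_⟩
  by_contra! h
  exact Q.no_radical ⟨z, fun q => (h q trivial).symm⟩

/-- If `x^⊥ ⊆ y^⊥` in `W` with `x ≠ y`, then a point `q` outside `y^⊥` is collinear with a unique
point `z` of the line `xy`, and `s^⊥ ⊆ z^⊥` for every `s ≠ z` on the line `qz`; since every point is
collinear with some point of `qz`, the point `z` is in the radical of `W`. -/
theorem IsNondegenerate.separate_points {W : Set P} (hW : Q.IsNondegenerate W) {x y : P}
    (hx : x ∈ W) (hy : y ∈ W) (hxy : x ≠ y) :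
    ∃ r ∈ W, Q.Collinear r x ∧ ¬ Q.Collinear r y := by
  by_cases hc : Q.Collinear x y
  swap
  · exact ⟨x, hx, collinear_self x, hc⟩
  by_contra! h
  obtain ⟨L, hL, hxL, hyL⟩ := hc
  have key : ∀ q ∈ W, ¬ Q.Collinear q y → ∀ z ∈ L, Q.Collinear q z → ∀ w ∈ W,
      Q.Collinear w q → Q.Collinear w z := by
    intro q hq hqy z hz hqz w hw hwq
    by_cases hne : w = q
    · exact hne ▸ hqz
    obtain ⟨K, hK, hwK, hqK⟩ := hwq
    obtain ⟨v, hvK, hxv⟩ := exists_collinear_on_line x hK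
    have hvW := hW.1.line_subset hw hq hne hK hwK hqK hvK
    have hvy := h v hvW hxv.symm
    have hvq : v ≠ q := fun e => hqy (e ▸ hvy)
    have hzv := (collinear_of_two hL hxL hyL hxy hxv.symm hvy hz).symm
    exact (collinear_of_two hK hvK hqK hvq hzv hqz.symm hwK).symm
  obtain ⟨q, hq, hqy⟩ := hW.2 y hy
  obtain ⟨z, hzL, hqz⟩ := exists_collinear_on_line q hL
  have hyz : Q.Collinear y z := collinear_of_mem hL hyL hzL
  have hqz' : q ≠ z := fun e => hqy (e ▸ hyz.symm)
  obtain ⟨K, hK, hqK, hzK⟩ := hqz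
  have hzW := hW.1.line_subset hx hy hxy hL hxL hyL hzL
  obtain ⟨r, hr, hrz⟩ := hW.2 z hzW
  obtain ⟨s, hsK, hrs⟩ := exists_collinear_on_line r hK
  have hsz : s ≠ z := fun e => hrz (e ▸ hrs)
  have hsy : ¬ Q.Collinear s y := fun e =>
    hqy (collinear_of_two hK hsK hzK hsz e.symm hyz hqK).symm
  exact hrz (key s (hW.1.line_subset hq hzW hqz' hK hqK hzK hsK) hsy z hzL
    (collinear_of_mem hK hsK hzK) r hr hrs)

theorem IsNondegenerate.inter_perp_pair {W : Set P} (hW : Q.IsNondegenerate W) {x y : P}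
    (hx : x ∈ W) (hxy : ¬ Q.Collinear x y) :
    Q.IsNondegenerate (W ∩ Q.perp {x, y}) := by
  refine ⟨hW.1.inter (isSubspace_perp _), ?_⟩
  rintro z ⟨hz, hz'⟩
  have hzx := hz' x (by simp)
  have hzy := hz' y (by simp)
  by_contra! h
  have hxz : x ≠ z := fun e => hxy (e ▸ hzy)
  obtain ⟨r, hr, hrx, hrz⟩ := hW.separate_points hx hz hxz
  have hrx' : r ≠ x := fun e => hrz (e ▸ hzx.symm)
  obtain ⟨K, hK, hrK, hxK⟩ := hrx
  obtain ⟨v, hvK, hyv⟩ := exists_collinear_on_line y hK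
  have hvx : v ≠ x := fun e => hxy (e ▸ hyv.symm)
  have hvW := hW.1.line_subset hr hx hrx' hK hrK hxK hvK
  have hvz := h v ⟨hvW, by
    rintro w (rfl | rfl)
    · exact collinear_of_mem hK hvK hxK
    · exact hyv.symm⟩
  exact hrz (collinear_of_two hK hvK hxK hvx hvz.symm hzx hrK).symm

theorem IsNondegenerate.separate_line {W : Set P} (hW : Q.IsNondegenerate W) {a c e : P}
    (ha : a ∈ W) (hc : c ∈ W) (he : e ∈ W) {L : Set P} (hL : L ∈ Q.lines) (haL : a ∈ L)
    (hcL : c ∈ L) (hac : a ≠ c) (heL : e ∉ L) (hea : Q.Collinear a e) :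
    ∃ r ∈ W, Q.Collinear r a ∧ Q.Collinear r c ∧ ¬ Q.Collinear r e := by
  obtain ⟨u, hu, hua⟩ := hW.2 a ha
  have hae : a ≠ e := fun h => heL (h ▸ haL)
  obtain ⟨K, hK, haK, heK⟩ := hea
  obtain ⟨k, hkL, huk⟩ := exists_collinear_on_line u hL
  obtain ⟨e', heK', hue⟩ := exists_collinear_on_line u hK
  have hka : k ≠ a := fun h => hua (h ▸ huk)
  have hea : e' ≠ a := fun h => hua (h ▸ hue)
  have hke : k ≠ e' := by
    rintro rfl
    exact heL (Q.line_unique a k hka.symm L hL K hK haL hkL haK heK' ▸ heK)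
  have hW' := hW.inter_perp_pair ha (fun h => hua h.symm)
  have hk : k ∈ W ∩ Q.perp {a, u} := by
    refine ⟨hW.1.line_subset ha hc hac hL haL hcL hkL, ?_⟩
    rintro w (rfl | rfl)
    · exact collinear_of_mem hL hkL haL
    · exact huk.symm
  have he' : e' ∈ W ∩ Q.perp {a, u} := by
    refine ⟨hW.1.line_subset ha he hae hK haK heK heK', ?_⟩
    rintro w (rfl | rfl)
    · exact collinear_of_mem hK heK' haK
    · exact hue.symm
  obtain ⟨r, hr, hrk, hre⟩ := hW'.separate_points hk he' hke
  have hra := hr.2 a (by simp)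
  exact ⟨r, hr.1, hra, collinear_of_two hL hkL haL hka hrk hra hcL,
    fun h => hre (collinear_of_two hK haK heK hae hra h heK')⟩

/-- The Veblen–Young axiom: if the points `p, a, b` and `p, c, d` are on two lines and `a`, `c` are
collinear, then the lines `ac` and `bd` intersect. -/
theorem veblen {p a b c d : P} {L₁ L₂ K₁ K₂ : Set P} (hL₁ : L₁ ∈ Q.lines) (hL₂ : L₂ ∈ Q.lines)
    (hK₁ : K₁ ∈ Q.lines) (hK₂ : K₂ ∈ Q.lines) (hL : L₁ ≠ L₂)
    (hp₁ : p ∈ L₁) (ha₁ : a ∈ L₁) (hb₁ : b ∈ L₁) (hp₂ : p ∈ L₂) (hc₂ : c ∈ L₂) (hd₂ : d ∈ L₂)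
    (hpa : p ≠ a) (hpb : p ≠ b) (hpc : p ≠ c)
    (ha : a ∈ K₁) (hc : c ∈ K₁) (hb : b ∈ K₂) (hd : d ∈ K₂) : ∃ e, e ∈ K₁ ∧ e ∈ K₂ := by
  have hac : a ≠ c := by
    rintro rfl
    exact hL (Q.line_unique p a hpa L₁ hL₁ L₂ hL₂ hp₁ ha₁ hp₂ hc₂)
  have hbd : b ≠ d := by
    rintro rfl
    exact hL (Q.line_unique p b hpb L₁ hL₁ L₂ hL₂ hp₁ hb₁ hp₂ hd₂)
  have hpK : p ∉ K₁ := fun h => hL <|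
    (Q.line_unique p a hpa L₁ hL₁ K₁ hK₁ hp₁ ha₁ h ha).trans
      (Q.line_unique p c hpc L₂ hL₂ K₁ hK₁ hp₂ hc₂ h hc).symm
  have cap : Q.Collinear a p := collinear_of_mem hL₁ ha₁ hp₁
  have cab : Q.Collinear a b := collinear_of_mem hL₁ ha₁ hb₁
  have cac : Q.Collinear a c := collinear_of_mem hK₁ ha hc
  have cad : Q.Collinear a d := collinear_of_two hL₂ hp₂ hc₂ hpc cap cac hd₂
  obtain ⟨q, -, hqa, hqc, hqp⟩ := isNondegenerate_univ.separate_line (Q := Q) (e := p) trivial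
    trivial trivial hK₁ ha hc hac hpK cap
  obtain ⟨e, heK, hqe⟩ := exists_collinear_on_line q hK₂
  refine ⟨e, ?_, heK⟩
  by_contra heK'
  have hW := isNondegenerate_univ.inter_perp_pair (Q := Q) (x := p) trivial (fun h => hqp h.symm)
  have cpe : Q.Collinear p e := collinear_of_two hK₂ hb hd hbd
    (collinear_of_mem hL₁ hp₁ hb₁) (collinear_of_mem hL₂ hp₂ hd₂) heK
  have cae : Q.Collinear a e := collinear_of_two hK₂ hb hd hbd cab cad heK
  have mem : ∀ {x}, Q.Collinear p x → Q.Collinear q x → x ∈ Set.univ ∩ Q.perp {p, q} := by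
    intro x h₁ h₂
    refine ⟨trivial, ?_⟩
    rintro w (rfl | rfl)
    · exact h₁.symm
    · exact h₂.symm
  obtain ⟨r, hr, hra, hrc, hre⟩ := hW.separate_line (mem cap.symm hqa)
    (mem (collinear_of_mem hL₂ hp₂ hc₂) hqc) (mem cpe hqe) hK₁ ha hc hac heK' cae
  have hrp := hr.2 p (by simp)
  exact hre (collinear_of_two hK₂ hb hd hbd (collinear_of_two hL₁ hp₁ ha₁ hpa hrp hra hb₁)
    (collinear_of_two hL₂ hp₂ hc₂ hpc hrp hrc hd₂) heK)

end PolarSpace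

namespace PolarSpace

variable {P : Type*} {Q : PolarSpace P}

/-! ### Dimension theory of singular subspaces -/

variable (Q) in
/-- The cone with apex `p` over `S`: the union of `{p}` and all lines joining `p` to points of
`S`. -/
def cone (p : P) (S : Set P) : Set P :=
  {x | x = p ∨ ∃ s ∈ S, ∃ L ∈ Q.lines, p ∈ L ∧ s ∈ L ∧ x ∈ L}

theorem subset_cone {p : P} {S : Set P} (hp : p ∈ Q.perp S) : S ⊆ Q.cone p S := fun s hs =>
  let ⟨L, hL, hpL, hsL⟩ := hp s hs
  Or.inr ⟨s, hs, L, hL, hpL, hsL, hsL⟩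

theorem line_meets_of_cone {p : P} {S : Set P} (hS : Q.IsSingular S) (hpS : p ∉ S)
    {x y : P} (hx : x ∈ Q.cone p S) (hy : y ∈ Q.cone p S) (hxy : x ≠ y)
    {L : Set P} (hL : L ∈ Q.lines) (hxL : x ∈ L) (hyL : y ∈ L) : ∃ e ∈ S, e ∈ L := by
  rcases hx with rfl | ⟨s, hs, K, hK, hpK, hsK, hxK⟩
  · rcases hy with rfl | ⟨t, ht, K', hK', hpK', htK', hyK'⟩
    · exact absurd rfl hxy
    · exact ⟨t, ht, Q.line_unique _ _ hxy K' hK' L hL hpK' hyK' hxL hyL ▸ htK'⟩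
  rcases hy with rfl | ⟨t, ht, K', hK', hpK', htK', hyK'⟩
  · exact ⟨s, hs, Q.line_unique _ _ hxy K hK L hL hxK hpK hxL hyL ▸ hsK⟩
  by_cases hKK : K = K'
  · subst hKK
    exact ⟨s, hs, Q.line_unique _ _ hxy K hK L hL hxK hyK' hxL hyL ▸ hsK⟩
  by_cases hxp : p = x
  · subst hxp
    exact ⟨t, ht, Q.line_unique _ _ hxy K' hK' L hL hpK' hyK' hxL hyL ▸ htK'⟩
  have hps : p ≠ s := fun h => hpS (h ▸ hs)
  have hpt : p ≠ t := fun h => hpS (h ▸ ht)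
  have hst : s ≠ t := by
    rintro rfl
    exact hKK (Q.line_unique p s hps K hK K' hK' hpK hsK hpK' htK')
  obtain ⟨N, hN, hsN, htN⟩ := hS.2 s hs t ht hst
  obtain ⟨e, heN, heL⟩ := veblen hK hK' hN hL hKK hpK hsK hxK hpK' htK' hyK' hps hxp hpt
    hsN htN hxL hyL
  exact ⟨e, hS.1.line_subset hs ht hst hN hsN htN heN, heL⟩

theorem isSubspace_cone {p : P} {S : Set P} (hS : Q.IsSingular S) (hp : p ∈ Q.perp S)
    (hpS : p ∉ S) : Q.IsSubspace (Q.cone p S) := by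
  intro x hx y hy hxy L hL hxL hyL z hz
  by_cases hxyS : x ∈ S ∧ y ∈ S
  · exact subset_cone hp (hS.1.line_subset hxyS.1 hxyS.2 hxy hL hxL hyL hz)
  obtain ⟨e, heS, heL⟩ := line_meets_of_cone hS hpS hx hy hxy hL hxL hyL
  obtain ⟨y, hy, hyL, hyS⟩ : ∃ y ∈ Q.cone p S, y ∈ L ∧ y ∉ S := by
    by_cases h : x ∈ S
    · exact ⟨y, hy, hyL, fun h' => hxyS ⟨h, h'⟩⟩
    · exact ⟨x, hx, hxL, h⟩
  have hye : y ≠ e := fun h => hyS (h ▸ heS)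
  by_cases hyz : y = z
  · exact hyz ▸ hy
  rcases hy with rfl | ⟨t, ht, K, hK, hpK, htK, hyK⟩
  · exact Or.inr ⟨e, heS, L, hL, hyL, heL, hz⟩
  by_cases hKL : L = K
  · exact Or.inr ⟨t, ht, K, hK, hpK, htK, hKL ▸ hz⟩
  by_cases hpy : y = p
  · exact Or.inr ⟨e, heS, L, hL, hpy ▸ hyL, heL, hz⟩
  have hyt : y ≠ t := fun h => hyS (h ▸ ht)
  have hpt : p ≠ t := fun h => hpS (h ▸ ht)
  have het : e ≠ t := by
    rintro rfl
    exact hKL (Q.line_unique y e hye L hL K hK hyL heL hyK htK)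
  obtain ⟨N, hN, heN, htN⟩ := hS.2 e heS t ht het
  have hpz : Q.Collinear p z := collinear_of_two hL hyL heL hye
    (collinear_of_mem hK hpK hyK) (hp e heS) hz
  obtain ⟨M, hM, hpM, hzM⟩ := hpz
  obtain ⟨w, hwN, hwM⟩ := veblen hL hK hN hM hKL hyL heL hz hyK htK hpK hye hyz hyt heN htN hzM hpM
  exact Or.inr ⟨w, hS.1.line_subset heS ht het hN heN htN hwN, M, hM, hpM, hwM, hzM⟩

theorem span_insert_subset_cone {p : P} {S : Set P} (hS : Q.IsSingular S) (hp : p ∈ Q.perp S)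
    (hpS : p ∉ S) : Q.span (insert p S) ⊆ Q.cone p S :=
  span_subset (isSubspace_cone hS hp hpS) (Set.insert_subset (Or.inl rfl) (subset_cone hp))

variable (Q) in
/-- `H` is a geometric hyperplane of `S` or equal to `S`: a subspace of `S` that meets every line
contained in `S`. -/
def IsHyperplane (H S : Set P) : Prop :=
  Q.IsSubspace H ∧ H ⊆ S ∧ ∀ L ∈ Q.lines, L ⊆ S → ∃ e ∈ H, e ∈ L

theorem isHyperplane_span_insert {p : P} {S : Set P} (hS : Q.IsSingular S) (hp : p ∈ Q.perp S) :
    Q.IsHyperplane S (Q.span (insert p S)) := by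
  refine ⟨hS.1, (Set.subset_insert p S).trans (subset_span _), fun L hL hLS => ?_⟩
  obtain ⟨x, hx, y, hy, hxy⟩ := Q.two_points L hL
  by_cases hpS : p ∈ S
  · rw [Set.insert_eq_of_mem hpS, hS.1.span_eq] at hLS
    exact ⟨x, hLS hx, hx⟩
  have hc := span_insert_subset_cone hS hp hpS
  exact line_meets_of_cone hS hpS (hc (hLS hx)) (hc (hLS hy)) hxy hL hx hy

theorem IsHyperplane.span_insert {H S : Set P} (h : Q.IsHyperplane H S) (hS : Q.IsSingular S)
    {y : P} (hy : y ∈ S) (hyH : y ∉ H) : Q.span (insert y H) = S := by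
  refine (span_subset hS.1 (Set.insert_subset hy h.2.1)).antisymm fun z hz => ?_
  by_cases hzy : z = y
  · exact hzy ▸ subset_span _ (Set.mem_insert z H)
  obtain ⟨L, hL, hzL, hyL⟩ := hS.2 z hz y hy hzy
  obtain ⟨e, heH, heL⟩ := h.2.2 L hL (hS.1.line_subset hz hy hzy hL hzL hyL)
  have hye : y ≠ e := fun h => hyH (h ▸ heH)
  exact (isSubspace_span _).line_subset (subset_span _ (Set.mem_insert y H))
    (subset_span _ (Set.mem_insert_of_mem y heH)) hye hL hyL heL hzL

theorem IsHyperplane.inter {H S B : Set P} (h : Q.IsHyperplane H S) (hB : Q.IsSubspace B)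
    (hBS : B ⊆ S) : Q.IsHyperplane (B ∩ H) B := by
  refine ⟨hB.inter h.1, Set.inter_subset_left, fun L hL hLB => ?_⟩
  obtain ⟨e, heH, heL⟩ := h.2.2 L hL (hLB.trans hBS)
  exact ⟨e, ⟨hLB heL, heH⟩, heL⟩

theorem isHyperplane_inter_perp {S : Set P} (hS : Q.IsSubspace S) (p : P) :
    Q.IsHyperplane (S ∩ Q.perp {p}) S := by
  refine ⟨hS.inter (isSubspace_perp _), Set.inter_subset_left, fun L hL hLS => ?_⟩
  obtain ⟨e, heL, hpe⟩ := exists_collinear_on_line p hL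
  refine ⟨e, ⟨hLS heL, ?_⟩, heL⟩
  rintro _ rfl
  exact hpe.symm

variable (Q) in
/-- `S` is spanned by finitely many points. -/
def IsFinite (S : Set P) : Prop := ∃ X : Finset P, Q.span (X : Set P) = S

variable (Q) in
/-- The rank of `S`, i.e. its projective dimension plus `1`: the minimal number of points that span
`S`, with the junk value `0` if `S` is not finitely spanned. -/
noncomputable def rank (S : Set P) : ℕ :=
  sInf {k | ∃ X : Finset P, Q.span (X : Set P) = S ∧ X.card = k}

theorem IsFinite.exists_card {S : Set P} (h : Q.IsFinite S) :
    ∃ X : Finset P, Q.span (X : Set P) = S ∧ X.card = Q.rank S :=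
  let ⟨X, hX⟩ := h
  Nat.sInf_mem (s := {k | ∃ X : Finset P, Q.span (X : Set P) = S ∧ X.card = k}) ⟨_, X, hX, rfl⟩

theorem rank_le_card (X : Finset P) : Q.rank (Q.span (X : Set P)) ≤ X.card :=
  Nat.sInf_le ⟨X, rfl, rfl⟩

/-- Adding a point: with `X` spanning `S`, the set `insert p X` spans the join of `S` and `p`. -/
theorem IsFinite.span_insert {S : Set P} (h : Q.IsFinite S) (p : P) :
    Q.IsFinite (Q.span (insert p S)) ∧ Q.rank (Q.span (insert p S)) ≤ Q.rank S + 1 := by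
  classical
  obtain ⟨X, hX, hc⟩ := h.exists_card
  have h1 : Q.span ((insert p X : Finset P) : Set P) = Q.span (insert p S) := by
    rw [Finset.coe_insert, ← span_insert_span, hX]
  refine ⟨⟨_, h1⟩, ?_⟩
  rw [← h1, ← hc]
  exact (rank_le_card _).trans (Finset.card_insert_le p X)

/-- Proper subspaces of a singular subspace are spanned by fewer points. This is the Steinitz
exchange argument in a geometric form: if `X = insert x Y`, then `span Y` is a hyperplane of
`span X`, which cuts out a hyperplane of the given subspace. -/
theorem exists_card_lt [DecidableEq P] (X : Finset P) :
    ∀ S : Set P, Q.IsSingular (Q.span (X : Set P)) → Q.IsSubspace S → S ⊂ Q.span (X : Set P) →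
      ∃ Y : Finset P, Q.span (Y : Set P) = S ∧ Y.card < X.card := by
  induction X using Finset.induction_on with
  | empty =>
    intro S _ _ hlt
    rw [Finset.coe_empty, IsSubspace.empty.span_eq] at hlt
    exact absurd hlt not_lt_bot
  | insert x X hx ih =>
    intro S hX hS hlt
    rw [Finset.card_insert_of_notMem hx]
    rw [Finset.coe_insert] at hX hlt
    have hsub : Q.span (X : Set P) ⊆ Q.span (insert x (X : Set P)) :=
      span_mono (Set.subset_insert _ _)
    have hX' : Q.IsSingular (Q.span (X : Set P)) := hX.mono (isSubspace_span _) hsub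
    have hxp : x ∈ Q.perp (Q.span (X : Set P)) := fun y hy =>
      hX.collinear (subset_span _ (Set.mem_insert _ _)) (hsub hy)
    have hH := isHyperplane_span_insert hX' hxp
    rw [span_insert_span] at hH
    by_cases hSX : S ⊆ Q.span (X : Set P)
    · rcases hSX.eq_or_ssubset with h | h
      · exact ⟨X, h.symm, Nat.lt_succ_self _⟩
      · obtain ⟨Y, hY, hc⟩ := ih S hX' hS h
        exact ⟨Y, hY, hc.trans (Nat.lt_succ_self _)⟩
    obtain ⟨y, hyS, hyX⟩ := Set.not_subset.1 hSX
    have hne : S ∩ Q.span (X : Set P) ≠ Q.span (X : Set P) := fun h => by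
      have h1 : Q.span (X : Set P) ⊆ S := h ▸ Set.inter_subset_left
      have h2 := hH.span_insert hX (hlt.1 hyS) hyX
      exact hlt.2 (h2 ▸ span_subset hS (Set.insert_subset hyS h1))
    obtain ⟨Y, hY, hc⟩ := ih _ hX' (hS.inter (isSubspace_span _))
      (Set.inter_subset_right.ssubset_of_ne hne)
    refine ⟨insert y Y, ?_, (Finset.card_insert_le y Y).trans_lt (by omega)⟩
    rw [Finset.coe_insert, ← span_insert_span, hY]
    exact (hH.inter hS hlt.1).span_insert (hX.mono hS hlt.1) hyS fun h => hyX h.2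

theorem IsFinite.of_ssubset {S T : Set P} (hTf : Q.IsFinite T) (hT : Q.IsSingular T)
    (hS : Q.IsSubspace S) (hST : S ⊂ T) : Q.IsFinite S ∧ Q.rank S < Q.rank T := by
  classical
  obtain ⟨X, rfl, hX⟩ := hTf.exists_card
  obtain ⟨Y, rfl, hY⟩ := exists_card_lt X S hT hS hST
  exact ⟨⟨Y, rfl⟩, (rank_le_card Y).trans_lt (hX ▸ hY)⟩

theorem IsFinite.of_subset {S T : Set P} (hTf : Q.IsFinite T) (hT : Q.IsSingular T)
    (hS : Q.IsSubspace S) (hST : S ⊆ T) : Q.IsFinite S ∧ Q.rank S ≤ Q.rank T := by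
  rcases hST.eq_or_ssubset with rfl | h
  · exact ⟨hTf, le_rfl⟩
  · exact (hTf.of_ssubset hT hS h).imp_right le_of_lt

theorem eq_of_rank_le {S T : Set P} (hTf : Q.IsFinite T) (hT : Q.IsSingular T)
    (hS : Q.IsSubspace S) (hST : S ⊆ T) (h : Q.rank T ≤ Q.rank S) : S = T :=
  hST.eq_or_ssubset.resolve_right fun h' => absurd (hTf.of_ssubset hT hS h').2 (not_lt.2 h)

theorem rank_span_insert {S : Set P} (hS : Q.IsSingular S) (hSf : Q.IsFinite S) {p : P}
    (hp : p ∈ Q.perp S) (hpS : p ∉ S) : Q.rank (Q.span (insert p S)) = Q.rank S + 1 := by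
  apply le_antisymm (hSf.span_insert p).2
  refine ((hSf.span_insert p).1.of_ssubset (isSingular_span_insert hS hp) hS.1 ?_).2
  refine ((Set.subset_insert p S).trans (subset_span _)).ssubset_of_not_subset fun h => ?_
  exact hpS (h (subset_span _ (Set.mem_insert p S)))

theorem IsHyperplane.rank_le {H S : Set P} (h : Q.IsHyperplane H S) (hS : Q.IsSingular S)
    (hSf : Q.IsFinite S) : Q.rank S ≤ Q.rank H + 1 := by
  by_cases hSH : S ⊆ H
  · rw [hSH.antisymm h.2.1]
    exact Nat.le_succ _
  obtain ⟨y, hy, hyH⟩ := Set.not_subset.1 hSH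
  have := ((hSf.of_subset hS h.1 h.2.1).1.span_insert y).2
  rwa [h.span_insert hS hy hyH] at this

/-- One half of the dimension formula in the projective space `A`. -/
theorem rank_add_rank_le {A S T : Set P} (hA : Q.IsSingular A) (hAf : Q.IsFinite A)
    (hS : Q.IsSubspace S) (hT : Q.IsSubspace T) (hSA : S ⊆ A) (hTA : T ⊆ A) :
    Q.rank S + Q.rank T ≤ Q.rank (S ∩ T) + Q.rank A := by
  induction hk : Q.rank A - Q.rank S generalizing S with
  | zero =>
    rw [eq_of_rank_le hAf hA hS hSA (by omega), Set.inter_eq_right.2 hTA]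
    omega
  | succ k ih =>
    have hne : ¬ A ⊆ S := fun h => by
      rw [hSA.antisymm h] at hk
      omega
    obtain ⟨p, hpA, hpS⟩ := Set.not_subset.1 hne
    have hS' := hA.mono hS hSA
    have hp : p ∈ Q.perp S := fun x hx => hA.collinear hpA (hSA hx)
    have hr := rank_span_insert hS' (hAf.of_subset hA hS hSA).1 hp hpS
    have hsub : Q.span (insert p S) ⊆ A := span_subset hA.1 (Set.insert_subset hpA hSA)
    have h1 := ih (isSubspace_span _) hsub (by omega)
    have hH := isHyperplane_span_insert hS' hp
    have hB : Q.IsSubspace (Q.span (insert p S) ∩ T) := (isSubspace_span _).inter hT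
    have hBA : Q.span (insert p S) ∩ T ⊆ A := Set.inter_subset_right.trans hTA
    have h2 := (hH.inter hB Set.inter_subset_left).rank_le (hA.mono hB hBA)
      (hAf.of_subset hA hB hBA).1
    have h3 : Q.span (insert p S) ∩ T ∩ S = S ∩ T := by
      ext x
      constructor
      · exact fun h => ⟨h.2, h.1.2⟩
      · exact fun h => ⟨⟨hH.2.1 h.1, h.2⟩, h.1⟩
    rw [h3] at h2
    omega

/-- Passing from `B` to a larger singular subspace `H`, the rank of `S ∩ B^⊥` decreases by at most
the amount by which the rank of `B` grows, since each new point imposes one linear condition. -/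
theorem rank_inter_perp_add_le {S H B : Set P} (hS : Q.IsSingular S) (hSf : Q.IsFinite S)
    (hH : Q.IsSingular H) (hHf : Q.IsFinite H) (hB : Q.IsSubspace B) (hBH : B ⊆ H) :
    Q.rank (S ∩ Q.perp B) + Q.rank B ≤ Q.rank (S ∩ Q.perp H) + Q.rank H := by
  induction hk : Q.rank H - Q.rank B generalizing B with
  | zero => rw [eq_of_rank_le hHf hH hB hBH (by omega)]
  | succ k ih =>
    have hne : ¬ H ⊆ B := fun h => by
      rw [hBH.antisymm h] at hk
      omega
    obtain ⟨p, hpH, hpB⟩ := Set.not_subset.1 hne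
    have hp : p ∈ Q.perp B := fun x hx => hH.collinear hpH (hBH hx)
    have hr := rank_span_insert (hH.mono hB hBH) (hHf.of_subset hH hB hBH).1 hp hpB
    have h1 := ih (isSubspace_span _) (span_subset hH.1 (Set.insert_subset hpH hBH)) (by omega)
    have hC : Q.IsSubspace (S ∩ Q.perp B) := hS.1.inter (isSubspace_perp B)
    have h2 := (isHyperplane_inter_perp hC p).rank_le (hS.mono hC Set.inter_subset_left)
      (hSf.of_subset hS hC Set.inter_subset_left).1
    have h3 : S ∩ Q.perp B ∩ Q.perp {p} = S ∩ Q.perp (Q.span (insert p B)) := by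
      rw [perp_span]
      ext x
      constructor
      · rintro ⟨⟨hxS, hxB⟩, hxp⟩
        refine ⟨hxS, ?_⟩
        rintro y (rfl | hy)
        · exact hxp y rfl
        · exact hxB y hy
      · rintro ⟨hxS, hx⟩
        exact ⟨⟨hxS, fun y hy => hx y (Or.inr hy)⟩, fun y hy => hx y (Or.inl hy)⟩
    rw [h3] at h2
    omega

theorem isFinite_of_hasDim {S : Set P} {d : ℕ} (h : Q.HasDim S d) : Q.IsFinite S := by
  obtain ⟨X, hX, hc⟩ := h.1
  have hfin : X.Finite := Set.finite_of_encard_eq_coe (k := d + 1) (by exact_mod_cast hc)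
  exact ⟨hfin.toFinset, by rw [hfin.coe_toFinset, hX.2.2]⟩

theorem exists_isBase {S : Set P} (hSf : Q.IsFinite S) :
    ∃ X : Set P, Q.IsBase X S ∧ X.encard = Q.rank S := by
  obtain ⟨X, hX, hc⟩ := hSf.exists_card
  refine ⟨X, ⟨hX ▸ subset_span _, fun Y hY h => ?_, hX⟩, ?_⟩
  swap
  · rw [Set.encard_coe_eq_coe_finsetCard, hc]
  have hfin : Y.Finite := X.finite_toSet.subset hY.1
  have h1 := rank_le_card (Q := Q) hfin.toFinset
  rw [hfin.coe_toFinset, h, hX, ← hc] at h1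
  have h2 : hfin.toFinset ⊂ X := by rwa [← Finset.coe_ssubset, hfin.coe_toFinset]
  exact absurd (Finset.card_lt_card h2) (not_lt.2 h1)

theorem rank_le_of_isBase {S X : Set P} {k : ℕ} (h : Q.IsBase X S) (hk : X.encard = k) :
    Q.rank S ≤ k := by
  have hfin : X.Finite := Set.finite_of_encard_eq_coe hk
  have h1 := rank_le_card (Q := Q) hfin.toFinset
  rw [hfin.coe_toFinset, h.2.2] at h1
  rw [hfin.encard_eq_coe_toFinset_card] at hk
  exact h1.trans (by exact_mod_cast hk.le)

theorem hasDim_iff {S : Set P} (hSf : Q.IsFinite S) {d : ℕ} :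
    Q.HasDim S d ↔ Q.rank S = d + 1 := by
  obtain ⟨X, hX, hc⟩ := exists_isBase hSf
  have lb : ∀ k : ℕ, (∃ X : Set P, Q.IsBase X S ∧ X.encard = k + 1) → Q.rank S ≤ k + 1 :=
    fun k ⟨Y, hY, hk⟩ => rank_le_of_isBase (k := k + 1) hY (by exact_mod_cast hk)
  constructor
  · intro h
    refine le_antisymm (lb d h.1) ?_
    cases hr : Q.rank S with
    | zero =>
      rw [hr, Nat.cast_zero, Set.encard_eq_zero] at hc
      obtain ⟨Y, hY, hk⟩ := h.1
      have h1 : S = ∅ := by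
        rw [hc] at hX
        exact hX.2.2.symm.trans IsSubspace.empty.span_eq
      have h2 : Y = ∅ := Set.subset_empty_iff.1 (hY.1.trans h1.subset)
      rw [h2, Set.encard_empty] at hk
      exact absurd hk.symm (by exact_mod_cast Nat.succ_ne_zero d)
    | succ k => exact Nat.succ_le_succ (h.2 ⟨X, hX, by rw [hc, hr]; push_cast; rfl⟩)
  · intro h
    exact ⟨⟨X, hX, by rw [hc, h]; push_cast; rfl⟩, fun k hk => by have := lb k hk; omega⟩

end PolarSpace

namespace PolarSpace

variable {P : Type*} {Q : PolarSpace P}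

/-! ### Maximal singular subspaces -/

theorem exists_isMaximalSingular {S : Set P} (hS : Q.IsSingular S) :
    ∃ M, Q.IsMaximalSingular M ∧ S ⊆ M := by
  obtain ⟨M, hSM, hM⟩ := zorn_subset_nonempty {S | Q.IsSingular S} (fun C hC hch hne => by
    have pair : ∀ p ∈ ⋃₀ C, ∀ q ∈ ⋃₀ C, ∃ T ∈ C, p ∈ T ∧ q ∈ T := by
      rintro p ⟨T, hT, hp⟩ q ⟨T', hT', hq⟩
      rcases hch.total hT hT' with h | h
      · exact ⟨T', hT', h hp, hq⟩
      · exact ⟨T, hT, hp, h hq⟩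
    refine ⟨⋃₀ C, ⟨fun p hp q hq hpq L hL hpL hqL => ?_, fun p hp q hq hpq => ?_⟩,
      fun _ => Set.subset_sUnion_of_mem⟩
    · obtain ⟨T, hT, hpT, hqT⟩ := pair p hp q hq
      exact ((hC hT).1.line_subset hpT hqT hpq hL hpL hqL).trans (Set.subset_sUnion_of_mem hT)
    · obtain ⟨T, hT, hpT, hqT⟩ := pair p hp q hq
      exact (hC hT).2 p hpT q hqT hpq) S hS
  exact ⟨M, hM, hSM⟩

theorem mem_of_perp {M : Set P} (hM : Q.IsMaximalSingular M) {p : P}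
    (hp : p ∈ Q.perp M) : p ∈ M := by
  rw [hM.eq_of_subset (isSingular_span_insert hM.1 hp)
    ((Set.subset_insert p M).trans (subset_span _))]
  exact subset_span _ (Set.mem_insert p M)

theorem inter_isSingular {S T : Set P} (hS : Q.IsSingular S) (hT : Q.IsSingular T) :
    Q.IsSingular (S ∩ T) := hS.mono (hS.1.inter hT.1) Set.inter_subset_left

section HasRank

variable {n : ℕ}

theorem HasRank.isFinite (hr : Q.HasRank n) {S : Set P} (hS : Q.IsSingular S) :
    Q.IsFinite S := by
  obtain ⟨M, hM, hSM⟩ := exists_isMaximalSingular hS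
  exact ((isFinite_of_hasDim (hr M hM)).of_subset hM.1 hS.1 hSM).1

theorem HasRank.rank_mono (hr : Q.HasRank n) {S T : Set P} (hS : Q.IsSubspace S)
    (hT : Q.IsSingular T) (h : S ⊆ T) : Q.rank S ≤ Q.rank T :=
  ((hr.isFinite hT).of_subset hT hS h).2

theorem HasRank.rank_eq (hr : Q.HasRank n) (hn : 1 ≤ n) {M : Set P}
    (hM : Q.IsMaximalSingular M) : Q.rank M = n := by
  rw [(hasDim_iff (hr.isFinite hM.1)).1 (hr M hM), Nat.sub_add_cancel hn]

theorem HasRank.rank_le (hr : Q.HasRank n) (hn : 1 ≤ n) {S : Set P} (hS : Q.IsSingular S) :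
    Q.rank S ≤ n := by
  obtain ⟨M, hM, hSM⟩ := exists_isMaximalSingular hS
  exact (hr.rank_mono hS.1 hM.1 hSM).trans (hr.rank_eq hn hM).le

theorem HasRank.isMaximalSingular (hr : Q.HasRank n) (hn : 1 ≤ n) {S : Set P}
    (hS : Q.IsSingular S) (h : Q.rank S = n) : Q.IsMaximalSingular S := by
  obtain ⟨M, hM, hSM⟩ := exists_isMaximalSingular hS
  rw [eq_of_rank_le (hr.isFinite hM.1) hM.1 hS.1 hSM (by rw [hr.rank_eq hn hM, h])]
  exact hM

theorem HasRank.isMaximalSingular_iff (hr : Q.HasRank n) (hn : 1 ≤ n) {S : Set P} :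
    S ∈ Q.grassmannian (n - 1) ↔ Q.IsMaximalSingular S := by
  refine ⟨fun h => hr.isMaximalSingular hn h.1 ?_, fun h => ⟨h.1, hr S h⟩⟩
  rw [(hasDim_iff (hr.isFinite h.1)).1 h.2, Nat.sub_add_cancel hn]

theorem HasRank.rank_inter_lt (hr : Q.HasRank n) (hn : 1 ≤ n) {S T : Set P}
    (hS : Q.IsMaximalSingular S) (hT : Q.IsMaximalSingular T) (h : S ≠ T) :
    Q.rank (S ∩ T) < n := by
  by_contra hlt
  have h1 := eq_of_rank_le (hr.isFinite hS.1) hS.1 (hS.1.1.inter hT.1.1) Set.inter_subset_left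
    (by rw [hr.rank_eq hn hS]; omega)
  exact h (hS.eq_of_subset hT.1 (Set.inter_eq_left.1 h1))

/-- A neighbour of `S` in the dual polar graph that is closer to `T`: the join of a point
`p ∈ T \ S` with the hyperplane `S ∩ p^⊥` of `S`. -/
theorem HasRank.exists_closer (hr : Q.HasRank n) (hn : 1 ≤ n) {S T : Set P}
    (hS : Q.IsMaximalSingular S) (hT : Q.IsMaximalSingular T) (hST : S ≠ T) :
    ∃ S', Q.IsMaximalSingular S' ∧ Q.rank (S ∩ S') + 1 = n ∧
      Q.rank (S ∩ T) < Q.rank (S' ∩ T) := by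
  obtain ⟨p, hpT, hpS⟩ := Set.not_subset.1 fun h => hST (hT.eq_of_subset hS.1 h).symm
  have hH := isHyperplane_inter_perp hS.1.1 p
  have hHs := hS.1.mono hH.1 hH.2.1
  have hp : p ∈ Q.perp (S ∩ Q.perp {p}) := fun x hx => (hx.2 p rfl).symm
  have h1 := hH.rank_le hS.1 (hr.isFinite hS.1)
  have h2 := rank_span_insert hHs (hr.isFinite hHs) hp fun h => hpS h.1
  have hS's := isSingular_span_insert hHs hp
  have h3 := hr.rank_le hn hS's
  rw [hr.rank_eq hn hS] at h1
  have hS' := hr.isMaximalSingular hn hS's (by omega)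
  have hpS' : p ∈ Q.span (insert p (S ∩ Q.perp {p})) := subset_span _ (Set.mem_insert _ _)
  have hHS' : S ∩ Q.perp {p} ⊆ Q.span (insert p (S ∩ Q.perp {p})) :=
    (Set.subset_insert _ _).trans (subset_span _)
  have hne : S ≠ Q.span (insert p (S ∩ Q.perp {p})) := fun h => hpS (h.symm ▸ hpS')
  refine ⟨_, hS', ?_, ?_⟩
  · have h4 := hr.rank_inter_lt hn hS hS' hne
    have h5 := hr.rank_mono hHs.1 (inter_isSingular hS.1 hS's)
      (Set.subset_inter Set.inter_subset_left hHS')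
    omega
  · have hi := inter_isSingular hS's hT.1
    refine ((hr.isFinite hi).of_ssubset hi (hS.1.1.inter hT.1.1) ?_).2
    refine Set.ssubset_iff_subset_ne.2 ⟨?_, fun h => ?_⟩
    · refine fun x hx => ⟨hHS' ⟨hx.1, ?_⟩, hx.2⟩
      rintro _ rfl
      exact hT.1.collinear hx.2 hpT
    · have : p ∈ S ∩ T := h ▸ ⟨hpS', hpT⟩
      exact hpS this.1

end HasRank

section TypeD

variable {n : ℕ}

theorem IsTypeD.encard_eq_two (hQ : Q.IsTypeD n) (hn : 2 ≤ n) {H : Set P} (hH : Q.IsSingular H)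
    (h : Q.rank H + 1 = n) : {M : Set P | Q.IsMaximalSingular M ∧ H ⊆ M}.encard = 2 :=
  hQ.2 H hH ((hasDim_iff (hQ.1.isFinite hH)).2 (by omega))

theorem IsTypeD.eq_or_eq (hQ : Q.IsTypeD n) (hn : 2 ≤ n) {H S T U : Set P} (hH : Q.IsSingular H)
    (h : Q.rank H + 1 = n) (hS : Q.IsMaximalSingular S) (hT : Q.IsMaximalSingular T)
    (hU : Q.IsMaximalSingular U) (hHS : H ⊆ S) (hHT : H ⊆ T) (hHU : H ⊆ U) (hST : S ≠ T) :
    U = S ∨ U = T := by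
  obtain ⟨A, B, -, hAB⟩ := Set.encard_eq_two.1 (hQ.encard_eq_two hn hH h)
  have mem : ∀ {X}, Q.IsMaximalSingular X → H ⊆ X → X = A ∨ X = B := fun {X} hX hHX => by
    have : X ∈ ({A, B} : Set (Set P)) := hAB ▸ ⟨hX, hHX⟩
    exact this
  rcases mem hS hHS with rfl | rfl <;> rcases mem hT hHT with rfl | rfl <;>
    rcases mem hU hHU with rfl | rfl <;> simp_all

theorem IsTypeD.exists_ne (hQ : Q.IsTypeD n) (hn : 2 ≤ n) {H : Set P} (hH : Q.IsSingular H)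
    (h : Q.rank H + 1 = n) (S : Set P) : ∃ U, Q.IsMaximalSingular U ∧ H ⊆ U ∧ U ≠ S := by
  obtain ⟨A, B, hne, hAB⟩ := Set.encard_eq_two.1 (hQ.encard_eq_two hn hH h)
  have hA : A ∈ {M : Set P | Q.IsMaximalSingular M ∧ H ⊆ M} := hAB ▸ by simp
  have hB : B ∈ {M : Set P | Q.IsMaximalSingular M ∧ H ⊆ M} := hAB ▸ by simp
  by_cases hAS : A = S
  · exact ⟨B, hB.1, hB.2, fun hBS => hne (hAS.trans hBS.symm)⟩
  · exact ⟨A, hA.1, hA.2, hAS⟩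

/-- The distances from `S` to two adjacent vertices of the dual polar graph differ by `1`. The
intersections of `S` with `T` and `T'` are not both inside `H = T ∩ T'`: by a dimension count
there is a point `p ∈ S ∩ H^⊥` outside `H`, and the join of `H` and `p` is `T` or `T'`. If both
intersections leave `H`, points of `S` outside `H` in `T` and in `T'` are collinear, so the former
is perpendicular to `T'`. -/
theorem IsTypeD.rank_inter_adj (hQ : Q.IsTypeD n) (hn : 2 ≤ n) {S T T' : Set P}
    (hS : Q.IsMaximalSingular S) (hT : Q.IsMaximalSingular T) (hT' : Q.IsMaximalSingular T')
    (h : Q.rank (T ∩ T') + 1 = n) :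
    Q.rank (S ∩ T) = Q.rank (S ∩ T') + 1 ∨ Q.rank (S ∩ T') = Q.rank (S ∩ T) + 1 := by
  have hr := hQ.1
  have hn1 : 1 ≤ n := by omega
  have hTT' : T ≠ T' := by
    rintro rfl
    rw [Set.inter_self, hr.rank_eq hn1 hT] at h
    omega
  have hHs := inter_isSingular hT.1 hT'.1
  have hHr : Q.rank (T ∩ T') = n - 1 := by omega
  -- `S ∩ H` has corank at most `1` in `S ∩ X` for any maximal singular `X ⊇ H`
  have hyp : ∀ {X}, Q.IsMaximalSingular X → T ∩ T' ⊆ X →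
      Q.rank (S ∩ X) ≤ Q.rank (S ∩ (T ∩ T')) + 1 := by
    intro X hX hHX
    have h1 := rank_add_rank_le hX.1 (hr.isFinite hX.1) (hS.1.1.inter hX.1.1) hHs.1
      Set.inter_subset_right hHX
    have h2 : S ∩ X ∩ (T ∩ T') = S ∩ (T ∩ T') := by
      rw [Set.inter_assoc, Set.inter_eq_right.2 hHX]
    rw [h2, hr.rank_eq hn1 hX] at h1
    omega
  have up : ∀ {X p}, Q.IsMaximalSingular X → T ∩ T' ⊆ X → p ∈ S → p ∈ X → p ∉ T ∩ T' →
      Q.rank (S ∩ X) = Q.rank (S ∩ (T ∩ T')) + 1 := by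
    intro X p hX hHX hpS hpX hpH
    have hi := inter_isSingular hS.1 hX.1
    have h1 := ((hr.isFinite hi).of_ssubset hi (hS.1.1.inter hHs.1)
      ((Set.inter_subset_inter_right S hHX).ssubset_of_not_subset
        fun h => hpH (h ⟨hpS, hpX⟩).2)).2
    have h2 := hyp hX hHX
    omega
  have same : ∀ {X}, T ∩ T' ⊆ X → S ∩ X ⊆ T ∩ T' → S ∩ X = S ∩ (T ∩ T') := fun hHX hsub =>
    (Set.subset_inter Set.inter_subset_left hsub).antisymm (Set.inter_subset_inter_right S hHX)
  by_cases h1 : S ∩ T ⊆ T ∩ T' <;> by_cases h2 : S ∩ T' ⊆ T ∩ T'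
  · exfalso
    have h3 := rank_inter_perp_add_le hS.1 (hr.isFinite hS.1) hHs (hr.isFinite hHs)
      (hS.1.1.inter hHs.1) Set.inter_subset_right
    have h4 : S ∩ Q.perp (S ∩ (T ∩ T')) = S :=
      Set.inter_eq_left.2 fun x hx y hy => hS.1.collinear hx hy.1
    rw [h4, hr.rank_eq hn1 hS, hHr] at h3
    obtain ⟨p, hp, hpH⟩ : ∃ p ∈ S ∩ Q.perp (T ∩ T'), p ∉ T ∩ T' := by
      by_contra! hsub
      have := hr.rank_mono (hS.1.1.inter (isSubspace_perp _)) (inter_isSingular hS.1 hHs)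
        (fun x hx => ⟨hx.1, hsub x hx⟩ : S ∩ Q.perp (T ∩ T') ⊆ S ∩ (T ∩ T'))
      omega
    have h5 := rank_span_insert hHs (hr.isFinite hHs) hp.2 hpH
    have hX := hr.isMaximalSingular hn1 (isSingular_span_insert hHs hp.2) (by omega)
    have hpX : p ∈ Q.span (insert p (T ∩ T')) := subset_span _ (Set.mem_insert _ _)
    rcases hQ.eq_or_eq hn hHs h hT hT' hX Set.inter_subset_left Set.inter_subset_right
      ((Set.subset_insert _ _).trans (subset_span _)) hTT' with e | e
    · exact hpH (h1 ⟨hp.1, e ▸ hpX⟩)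
    · exact hpH (h2 ⟨hp.1, e ▸ hpX⟩)
  · right
    obtain ⟨p, hp, hpH⟩ := Set.not_subset.1 h2
    rw [same Set.inter_subset_left h1, up hT' Set.inter_subset_right hp.1 hp.2 hpH]
  · left
    obtain ⟨p, hp, hpH⟩ := Set.not_subset.1 h1
    rw [same Set.inter_subset_right h2, up hT Set.inter_subset_left hp.1 hp.2 hpH]
  · exfalso
    obtain ⟨p, hp, hpH⟩ := Set.not_subset.1 h1
    obtain ⟨q, hq, hqH⟩ := Set.not_subset.1 h2
    -- `T'` is the join of `H` and `q`, so `p` is collinear with all its points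
    have h3 : Q.span (insert q (T ∩ T')) = T' := by
      have hqp : q ∈ Q.perp (T ∩ T') := fun x hx => hT'.1.collinear hq.2 hx.2
      have h5 := rank_span_insert hHs (hr.isFinite hHs) hqp hqH
      exact (hr.isMaximalSingular hn1 (isSingular_span_insert hHs hqp) (by omega)).eq_of_subset
        hT'.1 (span_subset hT'.1.1 (Set.insert_subset hq.2 Set.inter_subset_right))
    refine hpH ⟨hp.2, mem_of_perp hT' ?_⟩
    rw [← h3, perp_span]
    rintro x (rfl | hx)
    · exact hS.1.collinear hp.1 hq.1
    · exact hT.1.collinear hp.2 hx.1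

/-! ### The two half-spin classes -/

theorem HasRank.adj_iff (hr : Q.HasRank n) (hn : 2 ≤ n) {S U : Q.grassmannian (n - 1)} :
    (Q.dualPolarGraph n).Adj S U ↔ Q.rank (S.1 ∩ U.1) + 1 = n := by
  have hi := hr.isFinite (inter_isSingular S.2.1 U.2.1)
  constructor
  · rintro ⟨-, h⟩
    have := (hasDim_iff hi).1 h
    omega
  · intro h
    refine ⟨?_, (hasDim_iff hi).2 (by omega)⟩
    rintro rfl
    have := hr.rank_eq (by omega) ((hr.isMaximalSingular_iff (by omega)).1 S.2)
    rw [Set.inter_self] at h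
    omega

theorem HasRank.exists_walk (hr : Q.HasRank n) (hn : 2 ≤ n) (S U : Q.grassmannian (n - 1)) :
    Nonempty ((Q.dualPolarGraph n).Walk S U) := by
  have hn1 : 1 ≤ n := by omega
  induction hk : n - Q.rank (S.1 ∩ U.1) using Nat.strong_induction_on generalizing S with
  | _ k ih =>
    by_cases hSU : S = U
    · exact hSU ▸ ⟨.nil⟩
    have hS := (hr.isMaximalSingular_iff hn1).1 S.2
    have hU := (hr.isMaximalSingular_iff hn1).1 U.2
    have hne : S.1 ≠ U.1 := fun h => hSU (Subtype.ext h)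
    obtain ⟨T, hT, h1, h2⟩ := hr.exists_closer hn1 hS hU hne
    have hlt := hr.rank_inter_lt hn1 hS hU hne
    obtain ⟨w⟩ := ih (n - Q.rank (T ∩ U.1)) (by omega) ⟨T, (hr.isMaximalSingular_iff hn1).2 hT⟩ rfl
    exact ⟨.cons ((hr.adj_iff hn).2 h1) w⟩

/-- The dual polar graph of type `D_n` is bipartite, with the rank of the intersection with a fixed
vertex `T` giving the colouring. -/
theorem IsTypeD.even_walk (hQ : Q.IsTypeD n) (hn : 2 ≤ n) (T : Set P) (hT : Q.IsMaximalSingular T)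
    {S U : Q.grassmannian (n - 1)} (w : (Q.dualPolarGraph n).Walk S U) :
    Even (w.length + Q.rank (T ∩ S.1) + Q.rank (T ∩ U.1)) := by
  induction w with
  | nil => simp [← two_mul]
  | @cons S V U h w ih =>
    have hmax := fun X : Q.grassmannian (n - 1) =>
      (hQ.1.isMaximalSingular_iff (by omega)).1 X.2
    have := hQ.rank_inter_adj hn hT (hmax S) (hmax V) ((hQ.1.adj_iff hn).1 h)
    rw [SimpleGraph.Walk.length_cons]
    grind

theorem IsTypeD.even_rank_add_dist (hQ : Q.IsTypeD n) (hn : 2 ≤ n)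
    (S₀ S U : Q.grassmannian (n - 1)) :
    Even (n + Q.rank (S.1 ∩ U.1) + (Q.dualPolarGraph n).dist S₀ S +
      (Q.dualPolarGraph n).dist S₀ U) := by
  have hmax := fun X : Q.grassmannian (n - 1) =>
    (hQ.1.isMaximalSingular_iff (by omega)).1 X.2
  obtain ⟨w₁, h₁⟩ := SimpleGraph.Reachable.exists_walk_length_eq_dist (hQ.1.exists_walk hn S₀ S)
  obtain ⟨w₂, h₂⟩ := SimpleGraph.Reachable.exists_walk_length_eq_dist (hQ.1.exists_walk hn S₀ U)
  have e₁ := hQ.even_walk hn S.1 (hmax S) w₁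
  have e₂ := hQ.even_walk hn S.1 (hmax S) w₂
  rw [Set.inter_self, hQ.1.rank_eq (by omega) (hmax S)] at e₁
  rw [h₁] at e₁
  rw [h₂] at e₂
  grind

theorem IsTypeD.mem_halfSpin_iff (hQ : Q.IsTypeD n) (hn : 2 ≤ n) {S₀ S U : Q.grassmannian (n - 1)}
    {δ : ℤˣ} (hS : S ∈ Q.halfSpin n S₀ δ) :
    U ∈ Q.halfSpin n S₀ δ ↔ Even (n + Q.rank (S.1 ∩ U.1)) := by
  have h := hQ.even_rank_add_dist hn S₀ S U
  have hS' : (-1 : ℤˣ) ^ (Q.dualPolarGraph n).dist S₀ S = δ := hS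
  change (-1 : ℤˣ) ^ (Q.dualPolarGraph n).dist S₀ U = δ ↔ _
  rw [← hS']
  rcases Nat.even_or_odd ((Q.dualPolarGraph n).dist S₀ S) with h₁ | h₁ <;>
    rcases Nat.even_or_odd ((Q.dualPolarGraph n).dist S₀ U) with h₂ | h₂ <;>
    simp only [h₁.neg_one_pow, h₂.neg_one_pow, (by decide : (1 : ℤˣ) ≠ -1),
      (by decide : (-1 : ℤˣ) ≠ 1), true_iff, false_iff] <;> grind

theorem IsTypeD.mem_halfSpin_neg_iff (hQ : Q.IsTypeD n) (hn : 2 ≤ n)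
    {S₀ S U : Q.grassmannian (n - 1)} {δ : ℤˣ} (hS : S ∈ Q.halfSpin n S₀ δ) :
    U ∈ Q.halfSpin n S₀ (-δ) ↔ Odd (n + Q.rank (S.1 ∩ U.1)) := by
  rw [← Nat.not_even_iff_odd, ← hQ.mem_halfSpin_iff hn hS]
  change (-1 : ℤˣ) ^ (Q.dualPolarGraph n).dist S₀ U = -δ ↔
    ¬ (-1 : ℤˣ) ^ (Q.dualPolarGraph n).dist S₀ U = δ
  generalize (-1 : ℤˣ) ^ (Q.dualPolarGraph n).dist S₀ U = x
  clear hS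
  revert x δ
  decide

end TypeD

end PolarSpace

namespace PolarSpace

variable {P : Type*} {Q : PolarSpace P}

/-! ### Triangles in the half-spin Grassmann graphs -/

section Triangles

variable {n : ℕ}

/-- If the traces of `S₁` and `S₂` span `S`, then `S₁ ∩ S₂` is perpendicular to `S`, hence is
contained in the maximal singular subspace `S`. -/
theorem inter_subset_or_span_ne {S S₁ S₂ : Set P} (hS : Q.IsMaximalSingular S)
    (hS₁ : Q.IsMaximalSingular S₁) (hS₂ : Q.IsMaximalSingular S₂) :
    S₁ ∩ S₂ ⊆ S ∨ Q.span (S ∩ S₁ ∪ S ∩ S₂) ≠ S := by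
  by_contra! h
  refine h.1 fun p hp => mem_of_perp hS ?_
  rw [← h.2, perp_span]
  rintro x (hx | hx)
  · exact hS₁.1.collinear hp.1 hx.2
  · exact hS₂.1.collinear hp.2 hx.2

/-- If `S ∩ S₁` and `S ∩ S₂` met in a subspace of rank less than `n - 3`, they would span `S`. -/
theorem HasRank.le_rank_inter_inter (hr : Q.HasRank n) (hn : 2 ≤ n) {S S₁ S₂ : Set P}
    (hS : Q.IsMaximalSingular S) (hS₁ : Q.IsMaximalSingular S₁) (hS₂ : Q.IsMaximalSingular S₂)
    (h₁ : Q.rank (S ∩ S₁) + 2 = n) (h₂ : Q.rank (S ∩ S₂) + 2 = n)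
    (h₁₂ : Q.rank (S₁ ∩ S₂) + 2 = n) : n ≤ Q.rank (S ∩ S₁ ∩ S₂) + 3 := by
  rcases inter_subset_or_span_ne hS hS₁ hS₂ with h | h
  · rw [Set.inter_assoc, Set.inter_eq_right.2 h]
    omega
  have hsub : Q.span (S ∩ S₁ ∪ S ∩ S₂) ⊆ S :=
    span_subset hS.1.1 (Set.union_subset Set.inter_subset_left Set.inter_subset_left)
  have hA := hS.1.mono (isSubspace_span _) hsub
  have h3 := ((hr.isFinite hS.1).of_ssubset hS.1 hA.1 (hsub.ssubset_of_ne h)).2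
  rw [hr.rank_eq (by omega) hS] at h3
  have h4 := rank_add_rank_le hA (hr.isFinite hA) (hS.1.1.inter hS₁.1.1) (hS.1.1.inter hS₂.1.1)
    (Set.subset_union_left.trans (subset_span _)) (Set.subset_union_right.trans (subset_span _))
  rw [← Set.inter_inter_distrib_left, ← Set.inter_assoc] at h4
  omega

theorem HasRank.rank_triple (hr : Q.HasRank n) (hn : 2 ≤ n) {S₁ S₂ S₃ : Set P}
    (hS₁ : Q.IsMaximalSingular S₁) (hS₂ : Q.IsMaximalSingular S₂) (hS₃ : Q.IsMaximalSingular S₃)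
    (h₁₂ : Q.rank (S₁ ∩ S₂) + 2 = n) (h₁₃ : Q.rank (S₁ ∩ S₃) + 2 = n)
    (h₂₃ : Q.rank (S₂ ∩ S₃) + 2 = n) (hnc : ¬ S₁ ∩ S₂ ⊆ S₃) :
    Q.rank (S₁ ∩ S₂ ∩ S₃) + 3 = n := by
  have h := hr.le_rank_inter_inter hn hS₁ hS₂ hS₃ h₁₂ h₁₃ h₂₃
  have hi := inter_isSingular hS₁.1 hS₂.1
  have h' := ((hr.isFinite hi).of_ssubset hi (hi.1.inter hS₃.1.1)
    (Set.inter_subset_left.ssubset_of_not_subset fun h => hnc (h.trans Set.inter_subset_right))).2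
  omega

theorem HasRank.not_inter_subset (hr : Q.HasRank n) {S₁ S₂ S₃ : Set P}
    (hS₁ : Q.IsMaximalSingular S₁) (hS₂ : Q.IsMaximalSingular S₂) (hS₃ : Q.IsMaximalSingular S₃)
    (h₁₂ : Q.rank (S₁ ∩ S₂) + 2 = n) (h₁₃ : Q.rank (S₁ ∩ S₃) + 2 = n)
    (hnc : ¬ S₁ ∩ S₂ ⊆ S₃) : ¬ S₁ ∩ S₃ ⊆ S₂ := fun h => by
  have hi := inter_isSingular hS₁.1 hS₂.1
  have := eq_of_rank_le (hr.isFinite hi) hi (hS₁.1.1.inter hS₃.1.1)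
    (Set.subset_inter Set.inter_subset_left h) (by omega)
  exact hnc (this ▸ Set.inter_subset_right)

theorem HasRank.le_rank_inter_of_special (hr : Q.HasRank n) (hn : 2 ≤ n) {S T U : Set P}
    (hS : Q.IsMaximalSingular S) (hT : Q.IsMaximalSingular T) (hU : Q.IsMaximalSingular U)
    (hSU : Q.rank (S ∩ U) + 1 = n) (hTU : Q.rank (T ∩ U) + 1 = n) :
    n ≤ Q.rank (S ∩ T ∩ U) + 2 := by
  have h := rank_add_rank_le hU.1 (hr.isFinite hU.1) (hS.1.1.inter hU.1.1) (hT.1.1.inter hU.1.1)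
    Set.inter_subset_right Set.inter_subset_right
  rw [← Set.inter_inter_distrib_right, hr.rank_eq (by omega) hU] at h
  omega

theorem HasRank.inter_subset_of_special (hr : Q.HasRank n) (hn : 2 ≤ n) {S T U : Set P}
    (hS : Q.IsMaximalSingular S) (hT : Q.IsMaximalSingular T) (hU : Q.IsMaximalSingular U)
    (hSU : Q.rank (S ∩ U) + 1 = n) (hTU : Q.rank (T ∩ U) + 1 = n)
    (hST : Q.rank (S ∩ T) + 2 = n) : S ∩ T ⊆ U := by
  have h := hr.le_rank_inter_of_special hn hS hT hU hSU hTU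
  have hi := inter_isSingular hS.1 hT.1
  exact Set.inter_eq_left.1 (eq_of_rank_le (hr.isFinite hi) hi (hi.1.inter hU.1.1)
    Set.inter_subset_left (by omega))

theorem HasRank.lt_rank_span (hr : Q.HasRank n) {S₁ S₂ S₃ : Set P}
    (hS₁ : Q.IsMaximalSingular S₁) (hS₂ : Q.IsMaximalSingular S₂) (hS₃ : Q.IsMaximalSingular S₃)
    (h₁₂ : Q.rank (S₁ ∩ S₂) + 2 = n) (h₁₃ : Q.rank (S₁ ∩ S₃) + 2 = n) (hnc : ¬ S₁ ∩ S₂ ⊆ S₃) :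
    n ≤ Q.rank (Q.span (S₁ ∩ S₂ ∪ S₁ ∩ S₃)) + 1 := by
  have hsub : Q.span (S₁ ∩ S₂ ∪ S₁ ∩ S₃) ⊆ S₁ :=
    span_subset hS₁.1.1 (Set.union_subset Set.inter_subset_left Set.inter_subset_left)
  have hD := hS₁.1.mono (isSubspace_span _) hsub
  have := ((hr.isFinite hD).of_ssubset hD (hS₁.1.1.inter hS₂.1.1)
    ((Set.subset_union_left.trans (subset_span _)).ssubset_of_not_subset fun h =>
      hr.not_inter_subset hS₁ hS₂ hS₃ h₁₂ h₁₃ hnc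
        ((Set.subset_union_right.trans ((subset_span _).trans h)).trans
          Set.inter_subset_right))).2
  omega

/-- A triangle not on a line is contained in a special subspace: the intersections `S₁ ∩ S₂` and
`S₁ ∩ S₃` span a hyperplane of `S₁`, and `U` is the other maximal singular subspace containing
it. That `U` meets `S₂` and `S₃` in hyperplanes follows from parity. -/
theorem IsTypeD.exists_special (hQ : Q.IsTypeD n) (hn : 2 ≤ n) {S₁ S₂ S₃ : Set P}
    (hS₁ : Q.IsMaximalSingular S₁) (hS₂ : Q.IsMaximalSingular S₂) (hS₃ : Q.IsMaximalSingular S₃)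
    (h₁₂ : Q.rank (S₁ ∩ S₂) + 2 = n) (h₁₃ : Q.rank (S₁ ∩ S₃) + 2 = n)
    (h₂₃ : Q.rank (S₂ ∩ S₃) + 2 = n) (hnc : ¬ S₁ ∩ S₂ ⊆ S₃) :
    ∃ U, Q.IsMaximalSingular U ∧ Q.rank (S₁ ∩ U) + 1 = n ∧ Q.rank (S₂ ∩ U) + 1 = n ∧
      Q.rank (S₃ ∩ U) + 1 = n := by
  have hr := hQ.1
  have hn1 : 1 ≤ n := by omega
  have hsub : Q.span (S₁ ∩ S₂ ∪ S₁ ∩ S₃) ⊆ S₁ :=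
    span_subset hS₁.1.1 (Set.union_subset Set.inter_subset_left Set.inter_subset_left)
  have hD := hS₁.1.mono (isSubspace_span _) hsub
  have h1 := hr.lt_rank_span hS₁ hS₂ hS₃ h₁₂ h₁₃ hnc
  have hne : Q.span (S₁ ∩ S₂ ∪ S₁ ∩ S₃) ≠ S₁ := by
    refine (inter_subset_or_span_ne hS₁ hS₂ hS₃).resolve_left fun h => ?_
    have hi := inter_isSingular hS₂.1 hS₃.1
    have h2 := hr.rank_mono hi.1 (inter_isSingular (inter_isSingular hS₁.1 hS₂.1) hS₃.1)
      (fun x hx => ⟨⟨h hx, hx.1⟩, hx.2⟩ : S₂ ∩ S₃ ⊆ S₁ ∩ S₂ ∩ S₃)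
    have h3 := hr.rank_triple hn hS₁ hS₂ hS₃ h₁₂ h₁₃ h₂₃ hnc
    omega
  have h2 := ((hr.isFinite hS₁.1).of_ssubset hS₁.1 hD.1 (hsub.ssubset_of_ne hne)).2
  rw [hr.rank_eq hn1 hS₁] at h2
  obtain ⟨U, hU, hDU, hUS⟩ := hQ.exists_ne hn hD (by omega) S₁
  have hlt := hr.rank_inter_lt hn1 hS₁ hU hUS.symm
  have h3 := hr.rank_mono hD.1 (inter_isSingular hS₁.1 hU.1) (Set.subset_inter hsub hDU)
  have hU₁ : Q.rank (S₁ ∩ U) + 1 = n := by omega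
  have other : ∀ {T}, Q.IsMaximalSingular T → Q.rank (S₁ ∩ T) + 2 = n → S₁ ∩ T ⊆ U →
      Q.rank (T ∩ U) + 1 = n := by
    intro T hT hTr hTU
    have h4 := hQ.rank_inter_adj hn hT hS₁ hU hU₁
    have h5 := hr.rank_mono (hS₁.1.1.inter hT.1.1) (inter_isSingular hT.1 hU.1)
      (Set.subset_inter Set.inter_subset_right hTU)
    rw [Set.inter_comm T S₁] at h4
    omega
  exact ⟨U, hU, hU₁, other hS₂ h₁₂ (Set.subset_union_left.trans ((subset_span _).trans hDU)),
    other hS₃ h₁₃ (Set.subset_union_right.trans ((subset_span _).trans hDU))⟩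

theorem IsTypeD.special_unique (hQ : Q.IsTypeD n) (hn : 2 ≤ n) {S₁ S₂ S₃ U U' : Set P}
    (hS₁ : Q.IsMaximalSingular S₁) (hS₂ : Q.IsMaximalSingular S₂) (hS₃ : Q.IsMaximalSingular S₃)
    (h₁₂ : Q.rank (S₁ ∩ S₂) + 2 = n) (h₁₃ : Q.rank (S₁ ∩ S₃) + 2 = n) (hnc : ¬ S₁ ∩ S₂ ⊆ S₃)
    (hU : Q.IsMaximalSingular U) (hU₁ : Q.rank (S₁ ∩ U) + 1 = n)
    (hU₂ : Q.rank (S₂ ∩ U) + 1 = n) (hU₃ : Q.rank (S₃ ∩ U) + 1 = n)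
    (hU' : Q.IsMaximalSingular U') (hU'₁ : Q.rank (S₁ ∩ U') + 1 = n)
    (hU'₂ : Q.rank (S₂ ∩ U') + 1 = n) (hU'₃ : Q.rank (S₃ ∩ U') + 1 = n) : U = U' := by
  have hr := hQ.1
  have hn1 : 1 ≤ n := by omega
  have hD : ∀ {U}, Q.IsMaximalSingular U → Q.rank (S₁ ∩ U) + 1 = n → Q.rank (S₂ ∩ U) + 1 = n →
      Q.rank (S₃ ∩ U) + 1 = n → Q.span (S₁ ∩ S₂ ∪ S₁ ∩ S₃) ⊆ S₁ ∩ U := by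
    intro U hU hU₁ hU₂ hU₃
    refine span_subset (hS₁.1.1.inter hU.1.1) (Set.union_subset ?_ ?_)
    · exact Set.subset_inter Set.inter_subset_left
        (hr.inter_subset_of_special hn hS₁ hS₂ hU hU₁ hU₂ h₁₂)
    · exact Set.subset_inter Set.inter_subset_left
        (hr.inter_subset_of_special hn hS₁ hS₃ hU hU₁ hU₃ h₁₃)
  have hDU := hD hU hU₁ hU₂ hU₃
  have hDU' := hD hU' hU'₁ hU'₂ hU'₃
  have hDs := hS₁.1.mono (isSubspace_span _) (hDU.trans Set.inter_subset_left)
  have h1 := hr.lt_rank_span hS₁ hS₂ hS₃ h₁₂ h₁₃ hnc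
  have h2 := hr.rank_mono hDs.1 (inter_isSingular hS₁.1 hU.1) hDU
  have ne : ∀ {U}, Q.rank (S₁ ∩ U) + 1 = n → S₁ ≠ U := by
    rintro _ h rfl
    rw [Set.inter_self, hr.rank_eq hn1 hS₁] at h
    omega
  exact (hQ.eq_or_eq hn hDs (by omega) hS₁ hU' hU (hDU.trans Set.inter_subset_left)
    (hDU'.trans Set.inter_subset_right) (hDU.trans Set.inter_subset_right)
    (ne hU'₁)).resolve_left (ne hU₁).symm

/-- If `M = S₁ ∩ S₂ ∩ S₃` is not in `S`, the intersections of `S` with `S₁ ∩ S₂` and `S₁ ∩ S₃`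
are distinct hyperplanes of these, and the subspace they span is in `S ∩ U`. -/
theorem HasRank.subset_or_special (hr : Q.HasRank n) (hn : 2 ≤ n) {S₁ S₂ S₃ S U : Set P}
    (hS₁ : Q.IsMaximalSingular S₁) (hS₂ : Q.IsMaximalSingular S₂) (hS₃ : Q.IsMaximalSingular S₃)
    (h₁₂ : Q.rank (S₁ ∩ S₂) + 2 = n) (h₁₃ : Q.rank (S₁ ∩ S₃) + 2 = n)
    (h₂₃ : Q.rank (S₂ ∩ S₃) + 2 = n) (hnc : ¬ S₁ ∩ S₂ ⊆ S₃)
    (hU : Q.IsMaximalSingular U) (hU₁ : Q.rank (S₁ ∩ U) + 1 = n)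
    (hU₂ : Q.rank (S₂ ∩ U) + 1 = n) (hU₃ : Q.rank (S₃ ∩ U) + 1 = n)
    (hS : Q.IsMaximalSingular S) (h₁ : Q.rank (S ∩ S₁) + 2 = n) (h₂ : Q.rank (S ∩ S₂) + 2 = n)
    (h₃ : Q.rank (S ∩ S₃) + 2 = n) (hodd : Odd (n + Q.rank (S ∩ U))) :
    S₁ ∩ S₂ ∩ S₃ ⊆ S ∨ Q.rank (S ∩ U) + 1 = n := by
  refine or_iff_not_imp_left.2 fun hM => ?_
  have hMs := inter_isSingular (inter_isSingular hS₁.1 hS₂.1) hS₃.1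
  have h4 := ((hr.isFinite hMs).of_ssubset hMs (hS.1.1.inter hMs.1)
    (Set.inter_subset_right.ssubset_of_not_subset fun h => hM (h.trans Set.inter_subset_left))).2
  have h5 := hr.rank_triple hn hS₁ hS₂ hS₃ h₁₂ h₁₃ h₂₃ hnc
  have h6 := hr.le_rank_inter_inter hn hS hS₁ hS₂ h₁ h₂ h₁₂
  have h7 := hr.le_rank_inter_inter hn hS hS₁ hS₃ h₁ h₃ h₁₃
  have hSU := inter_isSingular hS.1 hU.1
  have h12 := hr.inter_subset_of_special hn hS₁ hS₂ hU hU₁ hU₂ h₁₂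
  have h13 := hr.inter_subset_of_special hn hS₁ hS₃ hU hU₁ hU₃ h₁₃
  have h8 := rank_add_rank_le hSU (hr.isFinite hSU)
    ((hS.1.1.inter hS₁.1.1).inter hS₂.1.1) ((hS.1.1.inter hS₁.1.1).inter hS₃.1.1)
    (fun x hx => ⟨hx.1.1, h12 ⟨hx.1.2, hx.2⟩⟩) (fun x hx => ⟨hx.1.1, h13 ⟨hx.1.2, hx.2⟩⟩)
  have h9 : S ∩ S₁ ∩ S₂ ∩ (S ∩ S₁ ∩ S₃) = S ∩ (S₁ ∩ S₂ ∩ S₃) := by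
    ext x
    simp only [Set.mem_inter_iff]
    tauto
  rw [h9] at h8
  have h10 := hr.rank_le (by omega) hSU
  obtain ⟨k, hk⟩ := hodd
  omega

end Triangles

/-! ### Stars and special subspaces of the half-spin Grassmannians -/

section HalfSpin

variable {n : ℕ} {S₀ : Q.grassmannian (n - 1)} {δ : ℤˣ}

theorem HasRank.isMaximalSingular_coe (hr : Q.HasRank n) (hn : 1 ≤ n)
    (S : Q.grassmannian (n - 1)) : Q.IsMaximalSingular S.1 := (hr.isMaximalSingular_iff hn).1 S.2

theorem HasRank.halfSpinGraph_adj (hr : Q.HasRank n) (hn : 3 ≤ n) {S T : Q.halfSpin n S₀ δ} :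
    (Q.halfSpinGraph n S₀ δ).Adj S T ↔ Q.rank (S.1.1 ∩ T.1.1) + 2 = n := by
  have hi := hr.isFinite (inter_isSingular S.1.2.1 T.1.2.1)
  constructor
  · rintro ⟨-, h⟩
    have := (hasDim_iff hi).1 h
    omega
  · intro h
    refine ⟨?_, (hasDim_iff hi).2 (by omega)⟩
    rintro rfl
    rw [Set.inter_self, hr.rank_eq (by omega) (hr.isMaximalSingular_coe (by omega) S.1)] at h
    omega

theorem HasRank.hasDim_inter_iff (hr : Q.HasRank n) (hn : 2 ≤ n) (S U : Q.grassmannian (n - 1)) :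
    Q.HasDim (S.1 ∩ U.1) (n - 2) ↔ Q.rank (S.1 ∩ U.1) + 1 = n := by
  rw [hasDim_iff (hr.isFinite (inter_isSingular S.2.1 U.2.1))]
  omega

theorem IsTypeD.eq_or_adj (hQ : Q.IsTypeD n) (hn : 3 ≤ n) {S T : Q.halfSpin n S₀ δ}
    (h : n ≤ Q.rank (S.1.1 ∩ T.1.1) + 3) : S = T ∨ (Q.halfSpinGraph n S₀ δ).Adj S T := by
  refine or_iff_not_imp_left.2 fun hne => (hQ.1.halfSpinGraph_adj hn).2 ?_
  have h1 := hQ.1.rank_inter_lt (by omega) (hQ.1.isMaximalSingular_coe (by omega) S.1)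
    (hQ.1.isMaximalSingular_coe (by omega) T.1) fun h => hne (Subtype.ext (Subtype.ext h))
  obtain ⟨k, hk⟩ := (hQ.mem_halfSpin_iff (by omega) S.2).1 T.2
  omega

theorem rank_of_mem_grassmannian (hr : Q.HasRank n) (hn : 4 ≤ n) {M : Set P}
    (hM : M ∈ Q.grassmannian (n - 4)) : Q.rank M + 3 = n := by
  have := (hasDim_iff (hr.isFinite hM.1)).1 hM.2
  omega

theorem IsTypeD.isClique_of_isStar (hQ : Q.IsTypeD n) (hn : 4 ≤ n) {C : Set (Q.halfSpin n S₀ δ)}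
    (hC : Q.IsStar n S₀ δ C) : (Q.halfSpinGraph n S₀ δ).IsClique C := by
  obtain ⟨M, hM, rfl⟩ := hC
  intro S hS T hT hne
  refine (hQ.eq_or_adj (by omega) ?_).resolve_left hne
  have h := hQ.1.rank_mono hM.1.1 (inter_isSingular S.1.2.1 T.1.2.1) (Set.subset_inter hS hT)
  have h' := rank_of_mem_grassmannian hQ.1 hn hM
  omega

theorem IsTypeD.isClique_of_isSpecialSubspace (hQ : Q.IsTypeD n) (hn : 4 ≤ n)
    {C : Set (Q.halfSpin n S₀ δ)} (hC : Q.IsSpecialSubspace n S₀ δ C) :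
    (Q.halfSpinGraph n S₀ δ).IsClique C := by
  obtain ⟨U, hU, rfl⟩ := hC
  intro S hS T hT hne
  have hmax := hQ.1.isMaximalSingular_coe (by omega)
  refine (hQ.eq_or_adj (by omega) ?_).resolve_left hne
  have h := hQ.1.le_rank_inter_of_special (by omega) (hmax S.1) (hmax T.1) (hmax U)
    ((hQ.1.hasDim_inter_iff (by omega) _ _).1 hS) ((hQ.1.hasDim_inter_iff (by omega) _ _).1 hT)
  have h' := hQ.1.rank_mono ((S.1.2.1.1.inter T.1.2.1.1).inter U.2.1.1)
    (inter_isSingular S.1.2.1 T.1.2.1) Set.inter_subset_left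
  omega

/-- A triangle `A`, `B`, `C` of the half-spin Grassmann graph which is not on a line of the
half-spin Grassmannian (as witnessed by a vertex `D` adjacent to precisely two of them) is contained
in precisely one star and in precisely one special subspace, and these contain all vertices adjacent
to `A`, `B` and `C`. -/
theorem IsTypeD.exists_star_special (hQ : Q.IsTypeD n) (hn : 4 ≤ n) {A B C D : Q.halfSpin n S₀ δ}
    (hAB : (Q.halfSpinGraph n S₀ δ).Adj A B) (hAC : (Q.halfSpinGraph n S₀ δ).Adj A C)
    (hBC : (Q.halfSpinGraph n S₀ δ).Adj B C) (hDA : (Q.halfSpinGraph n S₀ δ).Adj D A)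
    (hDB : (Q.halfSpinGraph n S₀ δ).Adj D B) (hDC : ¬ (Q.halfSpinGraph n S₀ δ).Adj D C)
    (hne : D ≠ C) :
    ∃ X Y, Q.IsStar n S₀ δ X ∧ Q.IsSpecialSubspace n S₀ δ Y ∧ {A, B, C} ⊆ X ∧ {A, B, C} ⊆ Y ∧
      (∀ X', Q.IsStar n S₀ δ X' → {A, B, C} ⊆ X' → X' = X) ∧
      (∀ Y', Q.IsSpecialSubspace n S₀ δ Y' → {A, B, C} ⊆ Y' → Y' = Y) ∧
      ∀ S, (Q.halfSpinGraph n S₀ δ).Adj S A → (Q.halfSpinGraph n S₀ δ).Adj S B →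
        (Q.halfSpinGraph n S₀ δ).Adj S C → S ∈ X ∨ S ∈ Y := by
  have hr := hQ.1
  have hmax := hr.isMaximalSingular_coe (by omega)
  have hn2 : 2 ≤ n := by omega
  have hnc : ¬ A.1.1 ∩ B.1.1 ⊆ C.1.1 := fun h => by
    rw [hr.halfSpinGraph_adj (by omega)] at hAB hDA hDB
    refine (hQ.eq_or_adj (by omega) ?_).elim hne hDC
    have h1 := hr.le_rank_inter_inter hn2 (hmax D.1) (hmax A.1) (hmax B.1) hDA hDB hAB
    have h2 := hr.rank_mono ((D.1.2.1.1.inter A.1.2.1.1).inter B.1.2.1.1)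
      (inter_isSingular D.1.2.1 C.1.2.1) (fun x hx => ⟨hx.1.1, h ⟨hx.1.2, hx.2⟩⟩)
    omega
  rw [hr.halfSpinGraph_adj (by omega)] at hAB hAC hBC
  have hMr := hr.rank_triple hn2 (hmax A.1) (hmax B.1) (hmax C.1) hAB hAC hBC hnc
  have hMs := inter_isSingular (inter_isSingular A.1.2.1 B.1.2.1) C.1.2.1
  obtain ⟨U, hU, hUA, hUB, hUC⟩ :=
    hQ.exists_special hn2 (hmax A.1) (hmax B.1) (hmax C.1) hAB hAC hBC hnc
  obtain ⟨U, rfl⟩ : ∃ V : Q.grassmannian (n - 1), V.1 = U :=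
    ⟨⟨U, (hr.isMaximalSingular_iff (by omega)).2 hU⟩, rfl⟩
  have hUδ : U ∈ Q.halfSpin n S₀ (-δ) := by
    rw [hQ.mem_halfSpin_neg_iff hn2 A.2]
    exact ⟨n - 1, by omega⟩
  have mem_special : ∀ {S : Q.halfSpin n S₀ δ} {V : Q.grassmannian (n - 1)},
      S ∈ {S : Q.halfSpin n S₀ δ | Q.HasDim (S.1.1 ∩ V.1) (n - 2)} ↔
        Q.rank (S.1.1 ∩ V.1) + 1 = n := fun {S V} => hr.hasDim_inter_iff hn2 S.1 V
  refine ⟨_, _, ⟨A.1.1 ∩ B.1.1 ∩ C.1.1, ⟨hMs, (hasDim_iff (hr.isFinite hMs)).2 (by omega)⟩, rfl⟩,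
    ⟨U, hUδ, rfl⟩, ?_, ?_, ?_, ?_, ?_⟩
  · rintro S (rfl | rfl | rfl)
    · exact fun x hx => hx.1.1
    · exact fun x hx => hx.1.2
    · exact fun x hx => hx.2
  · rintro S (rfl | rfl | rfl)
    · exact mem_special.2 hUA
    · exact mem_special.2 hUB
    · exact mem_special.2 hUC
  · rintro _ ⟨M, hM, rfl⟩ h
    have hMA : M ⊆ A.1.1 := h (by simp)
    have hMB : M ⊆ B.1.1 := h (by simp)
    have hMC : M ⊆ C.1.1 := h (by simp)
    have h1 := rank_of_mem_grassmannian hr hn hM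
    rw [eq_of_rank_le (hr.isFinite hMs) hMs hM.1.1
      (Set.subset_inter (Set.subset_inter hMA hMB) hMC) (by omega)]
  · rintro _ ⟨V, hV, rfl⟩ h
    rw [Subtype.ext (hQ.special_unique hn2 (hmax A.1) (hmax B.1) (hmax C.1) hAB hAC hnc (hmax V)
      (mem_special.1 (h (by simp))) (mem_special.1 (h (by simp))) (mem_special.1 (h (by simp)))
      (hmax U) hUA hUB hUC)]
  · intro S hSA hSB hSC
    rw [hr.halfSpinGraph_adj (by omega)] at hSA hSB hSC
    rw [mem_special]
    exact hr.subset_or_special hn2 (hmax A.1) (hmax B.1) (hmax C.1) hAB hAC hBC hnc (hmax U)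
      hUA hUB hUC (hmax S.1) hSA hSB hSC ((hQ.mem_halfSpin_neg_iff hn2 S.2).1 hUδ)

end HalfSpin

end PolarSpace

/-! ### Stars and special subsets of the half-cube -/

namespace HalfCube

open scoped symmDiff

variable {m : ℕ}

/-- The vertex of the hypercube that differs from `u` in precisely the coordinates in `s`. -/
def flipOn (u : Fin m → Bool) (s : Finset (Fin m)) : Fin m → Bool :=
  fun i => xor (u i) (decide (i ∈ s))

theorem flipOn_ne_iff (u : Fin m → Bool) (s : Finset (Fin m)) (i : Fin m) :
    flipOn u s i ≠ u i ↔ i ∈ s := by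
  by_cases h : i ∈ s <;> simp [flipOn, h]

theorem exists_eq_flipOn (u v : Fin m → Bool) : ∃ s, v = flipOn u s := by
  refine ⟨Finset.univ.filter fun i => v i ≠ u i, funext fun i => ?_⟩
  cases hu : u i <;> cases hv : v i <;> simp [flipOn, hu, hv]

theorem flipOn_flipOn (u : Fin m → Bool) (s t : Finset (Fin m)) :
    flipOn (flipOn u s) t = flipOn u (s ∆ t) := by
  funext i
  by_cases hs : i ∈ s <;> by_cases ht : i ∈ t <;> simp [flipOn, Finset.mem_symmDiff, hs, ht]

theorem hammingDist_flipOn (u : Fin m → Bool) (s t : Finset (Fin m)) :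
    hammingDist (flipOn u s) (flipOn u t) = (s ∆ t).card := by
  unfold hammingDist
  congr 1
  ext i
  by_cases hs : i ∈ s <;> by_cases ht : i ∈ t <;> simp [flipOn, Finset.mem_symmDiff, hs, ht]

theorem hammingDist_flipOn_left (u : Fin m → Bool) (s : Finset (Fin m)) :
    hammingDist (flipOn u s) u = s.card := by
  unfold hammingDist
  congr 1
  ext i
  simp [flipOn_ne_iff]

theorem even_card_symmDiff {α : Type*} [DecidableEq α] (s t : Finset α) :
    Even ((s ∆ t).card) ↔ Even (s.card + t.card) := by
  have h : (s ∆ t).card = (s \ t).card + (t \ s).card :=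
    Finset.card_union_of_disjoint disjoint_sdiff_sdiff
  have h1 := Finset.card_sdiff_add_card_inter s t
  have h2 := Finset.card_sdiff_add_card_inter t s
  rw [Finset.inter_comm] at h2
  grind

theorem even_weight_flipOn (u : Fin m → Bool) (s : Finset (Fin m)) :
    Even (weight (flipOn u s)) ↔ Even (weight u + s.card) := by
  have h : (Finset.univ.filter fun i => flipOn u s i = true) =
      (Finset.univ.filter fun i => u i = true) ∆ s := by
    ext i
    by_cases hs : i ∈ s <;> simp [flipOn, Finset.mem_symmDiff, hs]
  unfold weight
  rw [h, even_card_symmDiff]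

/-- The vertex of the half-cube obtained by changing an odd number of coordinates of `u`. -/
def flipVertex {u : Fin m → Bool} (hu : Odd (weight u)) (s : Finset (Fin m)) (hs : Odd s.card) :
    Vertex m := ⟨flipOn u s, (even_weight_flipOn u s).2 (hu.add_odd hs)⟩

theorem exists_eq_flipVertex {u : Fin m → Bool} (hu : Odd (weight u)) (v : Vertex m) :
    ∃ s hs, v = flipVertex hu s hs := by
  obtain ⟨s, hs⟩ := exists_eq_flipOn u v.1
  have hv := v.2
  rw [hs, even_weight_flipOn] at hv
  exact ⟨s, by grind, Subtype.ext hs⟩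

theorem adj_flipVertex {u : Fin m → Bool} (hu : Odd (weight u)) {s t : Finset (Fin m)}
    (hs : Odd s.card) (ht : Odd t.card) :
    (graph m).Adj (flipVertex hu s hs) (flipVertex hu t ht) ↔ (s ∆ t).card = 2 := by
  change hammingDist _ _ = 2 ↔ _
  exact (hammingDist_flipOn u s t) ▸ Iff.rfl

theorem flipVertex_injective {u : Fin m → Bool} (hu : Odd (weight u)) {s t : Finset (Fin m)}
    (hs : Odd s.card) (ht : Odd t.card) (h : flipVertex hu s hs = flipVertex hu t ht) : s = t := by
  ext i
  rw [← flipOn_ne_iff u s i, ← flipOn_ne_iff u t i, show flipOn u s = flipOn u t from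
    congrArg Subtype.val h]

theorem card_symmDiff_singleton {α : Type*} [DecidableEq α] (s : Finset α) (d : α) :
    (s ∆ {d}).card = if d ∈ s then s.card - 1 else s.card + 1 := by
  split_ifs with h
  · rw [← Finset.card_erase_of_mem h]
    congr 1
    ext l
    simp only [Finset.mem_symmDiff, Finset.mem_erase, Finset.mem_singleton]
    grind
  · rw [← Finset.card_insert_of_notMem h]
    congr 1
    ext l
    simp only [Finset.mem_symmDiff, Finset.mem_insert, Finset.mem_singleton]
    grind

theorem adj_flipVertex_singletons {u : Fin m → Bool} (hu : Odd (weight u)) {a b : Fin m}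
    (hab : a ≠ b) (ha : Odd ({a} : Finset (Fin m)).card) (hb : Odd ({b} : Finset (Fin m)).card) :
    (graph m).Adj (flipVertex hu {a} ha) (flipVertex hu {b} hb) := by
  rw [adj_flipVertex, card_symmDiff_singleton, if_neg (by simpa using hab.symm),
    Finset.card_singleton]

theorem adj_flipVertex_singleton_iff {u : Fin m → Bool} (hu : Odd (weight u))
    {s : Finset (Fin m)} (h3 : s.card = 3) (hs : Odd s.card) {d : Fin m}
    (hd : Odd ({d} : Finset (Fin m)).card) :
    (graph m).Adj (flipVertex hu s hs) (flipVertex hu {d} hd) ↔ d ∈ s := by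
  rw [adj_flipVertex, card_symmDiff_singleton, h3]
  split_ifs with h <;> simp [h]

theorem flipVertex_ne_singleton {u : Fin m → Bool} (hu : Odd (weight u))
    {s : Finset (Fin m)} (h3 : s.card = 3) (hs : Odd s.card) {d : Fin m}
    (hd : Odd ({d} : Finset (Fin m)).card) : flipVertex hu s hs ≠ flipVertex hu {d} hd := by
  intro h
  rw [flipVertex_injective hu hs hd h, Finset.card_singleton] at h3
  omega

/-- The special subset with centre `u`. -/
def specialSubset (u : Fin m → Bool) : Set (Vertex m) := {v | hammingDist v.1 u = 1}

/-- The star of all vertices that agree with `u` outside of the coordinates `i`, `j`, `k`. -/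
def starAt (u : Fin m → Bool) (i j k : Fin m) : Set (Vertex m) :=
  {v | ∀ l, l ≠ i → l ≠ j → l ≠ k → v.1 l = u l}

theorem flipVertex_mem_specialSubset {u : Fin m → Bool} (hu : Odd (weight u))
    {s : Finset (Fin m)} (hs : Odd s.card) :
    flipVertex hu s hs ∈ specialSubset u ↔ ∃ l, s = {l} := by
  rw [← Finset.card_eq_one, ← hammingDist_flipOn_left u s]
  rfl

theorem flipVertex_mem_starAt {u : Fin m → Bool} (hu : Odd (weight u)) {i j k : Fin m}
    {s : Finset (Fin m)} (hs : Odd s.card) :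
    flipVertex hu s hs ∈ starAt u i j k ↔ s ⊆ {i, j, k} := by
  change (∀ l, l ≠ i → l ≠ j → l ≠ k → flipOn u s l = u l) ↔ _
  refine forall_congr' fun l => ?_
  have := flipOn_ne_iff u s l
  simp only [Finset.mem_insert, Finset.mem_singleton]
  tauto

theorem starAt_flipOn (u : Fin m → Bool) (i j k : Fin m) {s : Finset (Fin m)}
    (hs : s ⊆ {i, j, k}) :
    starAt (flipOn u s) i j k = starAt u i j k := by
  ext v
  refine forall_congr' fun l => ?_
  have := flipOn_ne_iff u s l
  have := @hs l
  simp only [Finset.mem_insert, Finset.mem_singleton] at this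
  grind

theorem odd_subset_triple {α : Type*} [DecidableEq α] {i j k : α} (hij : i ≠ j) (hik : i ≠ k)
    (hjk : j ≠ k) {s : Finset α} (hs : Odd s.card) (h : s ⊆ {i, j, k}) :
    s = {i} ∨ s = {j} ∨ s = {k} ∨ s = {i, j, k} := by
  have h3 := Finset.card_le_card h
  rw [Finset.card_eq_three.2 ⟨i, j, k, hij, hik, hjk, rfl⟩] at h3
  obtain ⟨c, hc⟩ := hs
  obtain h1 | h1 : s.card = 1 ∨ s.card = 3 := by omega
  · obtain ⟨l, rfl⟩ := Finset.card_eq_one.1 h1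
    have := h (Finset.mem_singleton_self l)
    simp only [Finset.mem_insert, Finset.mem_singleton] at this
    rcases this with rfl | rfl | rfl <;> simp
  · refine Or.inr (Or.inr (Or.inr (Finset.eq_of_subset_of_card_le h ?_)))
    rw [h1, Finset.card_eq_three.2 ⟨i, j, k, hij, hik, hjk, rfl⟩]

theorem IsStar.exists_eq_starAt (hm : 3 ≤ m) {X : Set (Vertex m)} (hX : IsStar X) :
    ∃ u, Odd (weight u) ∧ ∃ i j k, i ≠ j ∧ i ≠ k ∧ j ≠ k ∧ X = starAt u i j k := by
  obtain ⟨T, hT, u, rfl⟩ := hX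
  have hc : Tᶜ.card = 3 := by
    rw [Finset.card_compl, Fintype.card_fin]
    omega
  obtain ⟨i, j, k, hij, hik, hjk, hTc⟩ := Finset.card_eq_three.1 hc
  have key : {v : Vertex m | ∀ l ∈ T, v.1 l = u l} = starAt u i j k := by
    ext v
    refine forall_congr' fun l => ?_
    have : l ∈ Tᶜ ↔ l ∈ ({i, j, k} : Finset (Fin m)) := by rw [hTc]
    simp only [Finset.mem_compl, Finset.mem_insert, Finset.mem_singleton] at this
    tauto
  rcases Nat.even_or_odd (weight u) with hu | hu
  · refine ⟨flipOn u {i}, ?_, i, j, k, hij, hik, hjk, ?_⟩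
    · rw [← Nat.not_even_iff_odd, even_weight_flipOn, Finset.card_singleton]
      grind
    · rw [key, starAt_flipOn u i j k (by simp)]
  · exact ⟨u, hu, i, j, k, hij, hik, hjk, key⟩

theorem exists_odd_weight (hm : 1 ≤ m) : ∃ u : Fin m → Bool, Odd (weight u) := by
  refine ⟨flipOn (fun _ => false) {⟨0, hm⟩}, ?_⟩
  rw [← Nat.not_even_iff_odd, even_weight_flipOn]
  simp [weight]

/-- Any two odd vertices of the hypercube are connected by changing two coordinates at a time. -/
theorem odd_vertex_induction {p : (Fin m → Bool) → Prop} {u u' : Fin m → Bool}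
    (hu : Odd (weight u)) (hu' : Odd (weight u')) (h : p u)
    (step : ∀ v i j, Odd (weight v) → i ≠ j → p v → p (flipOn v {i, j})) : p u' := by
  obtain ⟨s, rfl⟩ := exists_eq_flipOn u u'
  obtain ⟨c, hc⟩ : Even s.card := by
    rw [← Nat.not_even_iff_odd, even_weight_flipOn] at hu'
    grind
  clear hu'
  induction c generalizing u s with
  | zero =>
    have h0 : flipOn u ∅ = u := funext fun i => by simp [flipOn]
    rwa [Finset.card_eq_zero.1 (by omega : s.card = 0), h0]
  | succ c ih =>
    obtain ⟨i, hi, j, hj, hij⟩ := Finset.one_lt_card.1 (by omega : 1 < s.card)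
    have hsub : ({i, j} : Finset (Fin m)) ⊆ s := by
      simp [Finset.insert_subset_iff, hi, hj]
    have h2 := Finset.card_pair hij
    have hs : flipOn u s = flipOn (flipOn u {i, j}) (s \ {i, j}) := by
      rw [flipOn_flipOn]
      congr 1
      ext l
      have := @hsub l
      rw [Finset.mem_symmDiff, Finset.mem_sdiff]
      tauto
    rw [hs]
    refine ih ?_ (step u i j hu hij h) _ ?_
    · rw [← Nat.not_even_iff_odd, even_weight_flipOn, h2]
      grind
    · rw [Finset.card_sdiff_of_subset hsub, h2]
      omega

end HalfCube

/-! ### Images of stars and special subsets -/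

open HalfCube

section Embedding

variable {P : Type*} {Q : PolarSpace P} {n m : ℕ} {S₀ : Q.grassmannian (n - 1)} {δ : ℤˣ}
  (f : HalfCube.graph m ↪g Q.halfSpinGraph n S₀ δ)

/-- The image of `X` is contained in a star. -/
def InStar (X : Set (Vertex m)) : Prop := ∃ C, Q.IsStar n S₀ δ C ∧ f '' X ⊆ C

/-- The image of `X` is contained in a special subspace. -/
def InSpecial (X : Set (Vertex m)) : Prop := ∃ C, Q.IsSpecialSubspace n S₀ δ C ∧ f '' X ⊆ C

/-- The star and the special subset meet in a triangle `u + eᵢ`, `u + eⱼ`, `u + eₖ`. The fourth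
vertex `u + eᵢ + eⱼ + eₖ` of the star is adjacent to no further vertex `u + eₗ` of the special
subset. So their images, which are in the unique star or in the unique special subspace containing
the image of the triangle, are not in the same one of these two cliques. -/
theorem inStar_xor_inSpecial (hn : 4 ≤ n) (hm : 4 ≤ m) (hQ : Q.IsTypeD n) {u : Fin m → Bool}
    (hu : Odd (weight u)) {i j k : Fin m} (hij : i ≠ j) (hik : i ≠ k) (hjk : j ≠ k) :
    (InSpecial f (specialSubset u) ∧ InStar f (starAt u i j k) ∧
        ¬ InStar f (specialSubset u) ∧ ¬ InSpecial f (starAt u i j k)) ∨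
      (InStar f (specialSubset u) ∧ InSpecial f (starAt u i j k) ∧
        ¬ InSpecial f (specialSubset u) ∧ ¬ InStar f (starAt u i j k)) := by
  have h1 : ∀ l : Fin m, Odd ({l} : Finset (Fin m)).card := fun l => by simp
  have h3 : ({i, j, k} : Finset (Fin m)).card = 3 :=
    Finset.card_eq_three.2 ⟨_, _, _, hij, hik, hjk, rfl⟩
  have h3' : Odd ({i, j, k} : Finset (Fin m)).card := h3 ▸ by decide
  obtain ⟨l, hl⟩ : ∃ l, l ∉ ({i, j, k} : Finset (Fin m)) := by
    by_contra! h
    have := Finset.card_le_card (fun l _ => h l : Finset.univ ⊆ ({i, j, k} : Finset (Fin m)))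
    rw [h3, Finset.card_univ, Fintype.card_fin] at this
    omega
  simp only [Finset.mem_insert, Finset.mem_singleton, not_or] at hl
  have h4 : ({i, j, l} : Finset (Fin m)).card = 3 :=
    Finset.card_eq_three.2 ⟨_, _, _, hij, Ne.symm hl.1, Ne.symm hl.2.1, rfl⟩
  have h4' : Odd ({i, j, l} : Finset (Fin m)).card := h4 ▸ by decide
  have hyy : ∀ {a b}, a ≠ b → (Q.halfSpinGraph n S₀ δ).Adj (f (flipVertex hu {a} (h1 a)))
      (f (flipVertex hu {b} (h1 b))) := fun hab =>
    f.map_adj_iff.2 (adj_flipVertex_singletons hu hab _ _)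
  have hxy : ∀ {d}, (Q.halfSpinGraph n S₀ δ).Adj (f (flipVertex hu {i, j, k} h3'))
      (f (flipVertex hu {d} (h1 d))) ↔ d ∈ ({i, j, k} : Finset (Fin m)) := fun {d} =>
    f.map_adj_iff.trans (adj_flipVertex_singleton_iff hu h3 _ _)
  have hxy' : ∀ {d}, (Q.halfSpinGraph n S₀ δ).Adj (f (flipVertex hu {i, j, l} h4'))
      (f (flipVertex hu {d} (h1 d))) ↔ d ∈ ({i, j, l} : Finset (Fin m)) := fun {d} =>
    f.map_adj_iff.trans (adj_flipVertex_singleton_iff hu h4 _ _)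
  -- the vertex `u + eᵢ + eⱼ + eₗ` shows that the image of the triangle is not on a line
  obtain ⟨X, Y, hX, hY, hTX, hTY, uX, uY, dich⟩ := hQ.exists_star_special hn (hyy hij) (hyy hik)
    (hyy hjk) (hxy'.2 (by simp)) (hxy'.2 (by simp))
    (mt hxy'.1 (by simp [hik.symm, hjk.symm, Ne.symm hl.2.2]))
    (f.injective.ne (flipVertex_ne_singleton hu h4 _ _))
  have sep : ∀ Z, (Q.halfSpinGraph n S₀ δ).IsClique Z → f (flipVertex hu {i, j, k} h3') ∈ Z →
      ∀ d ∉ ({i, j, k} : Finset (Fin m)), f (flipVertex hu {d} (h1 d)) ∉ Z :=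
    fun Z hZ hx d hd hdZ => hd (hxy.1 (hZ hx hdZ
      (f.injective.ne (flipVertex_ne_singleton hu h3 _ _))))
  have tri_special : ∀ Z, f '' specialSubset u ⊆ Z → {f (flipVertex hu {i} (h1 i)),
      f (flipVertex hu {j} (h1 j)), f (flipVertex hu {k} (h1 k))} ⊆ Z := by
    rintro Z hZ _ (rfl | rfl | rfl) <;>
      exact hZ (Set.mem_image_of_mem f ((flipVertex_mem_specialSubset hu _).2 ⟨_, rfl⟩))
  have tri_star : ∀ Z, f '' starAt u i j k ⊆ Z → {f (flipVertex hu {i} (h1 i)),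
      f (flipVertex hu {j} (h1 j)), f (flipVertex hu {k} (h1 k))} ⊆ Z := by
    rintro Z hZ _ (rfl | rfl | rfl) <;>
      exact hZ (Set.mem_image_of_mem f ((flipVertex_mem_starAt hu _).2 (by simp)))
  have key : ∀ Z Z', (Q.halfSpinGraph n S₀ δ).IsClique Z → (Q.halfSpinGraph n S₀ δ).IsClique Z' →
      {f (flipVertex hu {i} (h1 i)), f (flipVertex hu {j} (h1 j)),
        f (flipVertex hu {k} (h1 k))} ⊆ Z →
      {f (flipVertex hu {i} (h1 i)), f (flipVertex hu {j} (h1 j)),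
        f (flipVertex hu {k} (h1 k))} ⊆ Z' →
      (∀ d ∉ ({i, j, k} : Finset (Fin m)), f (flipVertex hu {d} (h1 d)) ∈ Z ∨
        f (flipVertex hu {d} (h1 d)) ∈ Z') →
      f (flipVertex hu {i, j, k} h3') ∈ Z →
      f '' specialSubset u ⊆ Z' ∧ f '' starAt u i j k ⊆ Z ∧
        ¬ f '' specialSubset u ⊆ Z ∧ ¬ f '' starAt u i j k ⊆ Z' := by
    intro Z Z' hZ hZ' hT hT' hd hx
    have hsp : f '' specialSubset u ⊆ Z' := by
      rintro _ ⟨v, hv, rfl⟩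
      obtain ⟨s, hs, rfl⟩ := exists_eq_flipVertex hu v
      obtain ⟨d, rfl⟩ := (flipVertex_mem_specialSubset hu hs).1 hv
      by_cases hdT : d ∈ ({i, j, k} : Finset (Fin m))
      · simp only [Finset.mem_insert, Finset.mem_singleton] at hdT
        rcases hdT with rfl | rfl | rfl <;> exact hT' (by simp)
      · exact (hd d hdT).resolve_left (sep Z hZ hx d hdT)
    have hl' : l ∉ ({i, j, k} : Finset (Fin m)) := by simp [hl]
    refine ⟨hsp, ?_, fun h => ?_, fun h => ?_⟩
    · rintro _ ⟨v, hv, rfl⟩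
      obtain ⟨s, hs, rfl⟩ := exists_eq_flipVertex hu v
      rcases odd_subset_triple hij hik hjk hs ((flipVertex_mem_starAt hu hs).1 hv) with
        rfl | rfl | rfl | rfl
      · exact hT (by simp)
      · exact hT (by simp)
      · exact hT (by simp)
      · exact hx
    · exact sep Z hZ hx l hl' (h (Set.mem_image_of_mem f
        ((flipVertex_mem_specialSubset hu _).2 ⟨_, rfl⟩)))
    · exact sep Z' hZ' (h (Set.mem_image_of_mem f ((flipVertex_mem_starAt hu _).2 subset_rfl))) l hl'
        (hsp (Set.mem_image_of_mem f ((flipVertex_mem_specialSubset hu _).2 ⟨_, rfl⟩)))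
  have hd : ∀ d ∉ ({i, j, k} : Finset (Fin m)), f (flipVertex hu {d} (h1 d)) ∈ X ∨
      f (flipVertex hu {d} (h1 d)) ∈ Y := by
    intro d hd
    simp only [Finset.mem_insert, Finset.mem_singleton, not_or] at hd
    exact dich _ (hyy hd.1) (hyy hd.2.1) (hyy hd.2.2)
  have hXc := hQ.isClique_of_isStar hn hX
  have hYc := hQ.isClique_of_isSpecialSubspace hn hY
  rcases dich _ (hxy.2 (by simp)) (hxy.2 (by simp)) (hxy.2 (by simp)) with hx | hx
  · left
    obtain ⟨k1, k2, k3, k4⟩ := key X Y hXc hYc hTX hTY hd hx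
    exact ⟨⟨Y, hY, k1⟩, ⟨X, hX, k2⟩,
      fun ⟨C, hC, h⟩ => k3 (uX C hC (tri_special C h) ▸ h),
      fun ⟨C, hC, h⟩ => k4 (uY C hC (tri_star C h) ▸ h)⟩
  · right
    obtain ⟨k1, k2, k3, k4⟩ := key Y X hYc hXc hTY hTX (fun d h => (hd d h).symm) hx
    exact ⟨⟨X, hX, k1⟩, ⟨Y, hY, k2⟩,
      fun ⟨C, hC, h⟩ => k3 (uY C hC (tri_special C h) ▸ h),
      fun ⟨C, hC, h⟩ => k4 (uX C hC (tri_star C h) ▸ h)⟩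

/-- The centres `u` and `u + eᵢ + eⱼ` have the star `starAt u i j k` in common, so the type of the
image of a special subset does not depend on its centre. -/
theorem inSpecial_iff (hn : 4 ≤ n) (hm : 4 ≤ m) (hQ : Q.IsTypeD n) {u u' : Fin m → Bool}
    (hu : Odd (weight u)) (hu' : Odd (weight u')) :
    InSpecial f (specialSubset u') ↔ InSpecial f (specialSubset u) := by
  refine odd_vertex_induction (p := fun v => InSpecial f (specialSubset v) ↔ _) hu hu' Iff.rfl ?_
  intro v i j hv hij ih
  obtain ⟨k, hk⟩ : ∃ k, k ∉ ({i, j} : Finset (Fin m)) := by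
    by_contra! h
    have := Finset.card_le_card (fun l _ => h l : Finset.univ ⊆ ({i, j} : Finset (Fin m)))
    rw [Finset.card_pair hij, Finset.card_univ, Fintype.card_fin] at this
    omega
  simp only [Finset.mem_insert, Finset.mem_singleton, not_or] at hk
  have hv' : Odd (weight (flipOn v {i, j})) := by
    rw [← Nat.not_even_iff_odd, even_weight_flipOn, Finset.card_pair hij]
    grind
  have h := inStar_xor_inSpecial f hn hm hQ hv hij (Ne.symm hk.1) (Ne.symm hk.2)
  have h' := inStar_xor_inSpecial f hn hm hQ hv' hij (Ne.symm hk.1) (Ne.symm hk.2)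
  rw [starAt_flipOn v i j k (by simp [Finset.insert_subset_iff])] at h'
  rw [← ih]
  tauto

end Embedding

theorem proposition4p1 {P : Type*} (Q : PolarSpace P) (n m : ℕ) (hn : 4 ≤ n) (hm : 4 ≤ m)
    (hQ : Q.IsTypeD n) (S₀ : Q.grassmannian (n - 1)) (δ : ℤˣ)
    (f : HalfCube.graph m ↪g Q.halfSpinGraph n S₀ δ) :
    Xor
      ((∀ X : Set (HalfCube.Vertex m), HalfCube.IsStar X →
          ∃ C, Q.IsStar n S₀ δ C ∧ f '' X ⊆ C) ∧
        (∀ X : Set (HalfCube.Vertex m), HalfCube.IsSpecialSubset X →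
          ∃ C, Q.IsSpecialSubspace n S₀ δ C ∧ f '' X ⊆ C))
      ((∀ X : Set (HalfCube.Vertex m), HalfCube.IsStar X →
          ∃ C, Q.IsSpecialSubspace n S₀ δ C ∧ f '' X ⊆ C) ∧
        (∀ X : Set (HalfCube.Vertex m), HalfCube.IsSpecialSubset X →
          ∃ C, Q.IsStar n S₀ δ C ∧ f '' X ⊆ C)) := by
  obtain ⟨u₀, hu₀⟩ := exists_odd_weight (m := m) (by omega)
  have star_case : ∀ X, HalfCube.IsStar X → ∃ u, Odd (weight u) ∧
      ((InSpecial f (specialSubset u) ∧ InStar f X) ∨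
        (¬ InSpecial f (specialSubset u) ∧ InSpecial f X)) := by
    intro X hX
    obtain ⟨u, hu, i, j, k, hij, hik, hjk, rfl⟩ := hX.exists_eq_starAt (by omega)
    have := inStar_xor_inSpecial f hn hm hQ hu hij hik hjk
    exact ⟨u, hu, by tauto⟩
  have special_case : ∀ u, Odd (weight u) → (InSpecial f (specialSubset u) ∧
      ¬ InStar f (specialSubset u)) ∨ (¬ InSpecial f (specialSubset u) ∧
        InStar f (specialSubset u)) := by
    intro u hu
    have := inStar_xor_inSpecial f hn hm hQ hu (i := ⟨0, by omega⟩) (j := ⟨1, by omega⟩)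
      (k := ⟨2, by omega⟩) (by simp) (by simp) (by simp)
    tauto
  have same : ∀ u, Odd (weight u) →
      (InSpecial f (specialSubset u) ↔ InSpecial f (specialSubset u₀)) :=
    fun u hu => inSpecial_iff f hn hm hQ hu₀ hu
  by_cases h : InSpecial f (specialSubset u₀)
  · refine Or.inl ⟨⟨fun X hX => ?_, ?_⟩, fun hB => ?_⟩
    · obtain ⟨u, hu, hX⟩ := star_case X hX
      exact (hX.resolve_right fun h' => h'.1 ((same u hu).2 h)).2
    · rintro _ ⟨u, hu, rfl⟩
      exact (same u hu).2 h
    · have hB' : InStar f (specialSubset u₀) := hB.2 _ ⟨u₀, hu₀, rfl⟩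
      have := special_case u₀ hu₀
      tauto
  · refine Or.inr ⟨⟨fun X hX => ?_, ?_⟩, fun hA => h (hA.2 _ ⟨u₀, hu₀, rfl⟩)⟩
    · obtain ⟨u, hu, hX⟩ := star_case X hX
      exact (hX.resolve_left fun h' => h ((same u hu).1 h'.1)).2
    · rintro _ ⟨u, hu, rfl⟩
      exact ((special_case u hu).resolve_left fun h' => h ((same u hu).1 h'.1)).2
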